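/- Conventions. Fix a grading group datum: an abelian group $\Gamma$, a symmetric bilinear form $\sigma\colon\Gamma\times\Gamma\to\mathbb Z/2$ and an element $1\in\Gamma$ with $\sigma(1,1)=1$ (for example $\Gamma=\mathbb Z$, $\sigma(a,b)=ab$); write $(-1)^i$ for $(-1)^{\sigma(1,i)}$. Complexes are $\Gamma$-graded, with differentials of degree $1$. For a DG-category $\mathbf E$, let $Z^0(\mathbf E)$ be the preadditive category with the same objects whose morphisms are the closed morphisms of degree $0$; $\mathbf E$ is additive if $Z^0(\mathbf E)$ is. A shift $X[i]$ is an object with a closed isomorphism $X\to X[i]$ of degree $-i$. A cone of a closed morphism $f\colon X\to Y$ of degree $0$ is an object representing the cones of the morphisms of complexes $f\circ-\colon\mathrm{Hom}^\bullet(Z,X)\to\mathrm{Hom}^\bullet(Z,Y)$. The DG-category $\mathbf E^\natural$ has as objects the pairs $(X,\sigma_X)$ with $X\in\mathbf E$, $\sigma_X\in\mathrm{Hom}^{-1}_{\mathbf E}(X,X)$, $d(\sigma_X)=\mathrm{id}_X$, $\sigma_X^2=0$; its morphisms $(X,\sigma_X)\to(Y,\sigma_Y)$ of degree $i$ are the closed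 morphisms $X\to Y$ of degree $-i$ in $\mathbf E$, with differential $d^\natural(f)=\sigma_Yf-(-1)^if\sigma_X$. It has shifts if $\mathbf E$ has them. Let $\mathbf E$ be an additive DG-category with shifts and cones. Put $\Xi(A)=\mathrm{cone}(\mathrm{id}_A[-1])$, a functor $Z^0(\mathbf E)\to Z^0(\mathbf E)$ with natural morphisms $A[-1]\to\Xi(A)\to A$. Let $\iota\in\mathrm{Hom}^1(A,\Xi(A))$, $\pi\in\mathrm{Hom}^0(\Xi(A),A)$, $\pi'\in\mathrm{Hom}^{-1}(\Xi(A),A)$, $\iota'\in\mathrm{Hom}^0(A,\Xi(A))$ be the structure morphisms of this cone, with $\pi'\iota'=0=\pi\iota$, $\pi'\iota=\mathrm{id}_A=\pi\iota'$, $\iota\pi'+\iota'\pi=\mathrm{id}_{\Xi(A)}$, $d\pi'=\pi$, $d\iota'=\iota$. Let $\Phi\colon Z^0(\mathbf E)\to Z^0(\mathbf E^\natural)$ be the functor $A\mapsto(\Xi(A),\iota'\pi')$ and $\Psi^+\colon Z^0(\mathbf E^\natural)\to Z^0(\mathbf E)$ the functor $(X,\sigma_X)\mapsto X$. Exact category structures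 (in the sense of Quillen) are taken on additive categories. An exact structure on $Z^0(\mathbf E)$ is *DG-compatible* if it is preserved by the shift functors $[1]$ and $[-1]$ and the sequence $0\to A[-1]\to\Xi(A)\to A\to0$ is an admissible short exact sequence for every object $A$. A pair of exact structures on $Z^0(\mathbf E)$ and $Z^0(\mathbf E^\natural)$ is *$\natural$-compatible* if both are preserved by the shifts $[1]$ and $[-1]$, and both functors $\Phi$ and $\Psi^+$ preserve and reflect admissible short exact sequences (a functor reflects them if every composable pair of morphisms taken to an admissible short exact sequence is itself an admissible short exact sequence). An *exact DG-category* structure on $\mathbf E$ is a $\natural$-compatible pair of exact structures on $Z^0(\mathbf E)$ and $Z^0(\mathbf E^\natural)$. **Theorem.** Let $\mathbf E$ be an additive DG-category with shifts and cones. 1. For every DG-compatible exact structure on $Z^0(\mathbf E)$ there is a unique exact structure on $Z^0(\mathbf E^\natural)$ that is $\natural$-compatible with it. 2. Sending a $\natural$-compatible pair to its first member is a bijection from the exact DG-category structures on $\mathbf E$ onto the DG-compatible exact structures on $Z^0(\mathbf E)$. -/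

import Mathlib

open CategoryTheory CategoryTheory.Limits

universe w v u

/-- A grading group datum on an abelian group `Γ`: a distinguished element `one` (the degree of
differentials) and a symmetric bilinear form with values in `ℤ/2` (governing signs), such that
the value of the form at `(one, one)` is `1`. -/
class GradingDatum (Γ : Type w) [AddCommGroup Γ] where
  one : Γ
  form : Γ →+ Γ →+ ZMod 2
  form_symm : ∀ a b, form a b = form b a
  form_one_one : form one one = 1

namespace GradingDatum

variable {Γ : Type w} [AddCommGroup Γ] [GradingDatum Γ]

/-- The sign `(-1)^i`, i.e. `(-1)^{σ(1,i)}`, attached to a degree `i`. -/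
def sign (i : Γ) : ℤˣ := (-1 : ℤˣ) ^ (form one i)

@[simp] lemma sign_deg_zero : sign (0 : Γ) = 1 := by simp [sign]

lemma sign_deg_one : sign (one : Γ) = -1 := by simp [sign, form_one_one]

lemma sign_add (i j : Γ) : sign (i + j) = sign i * sign j := by
  simp [sign, uzpow_add]

@[simp] lemma sign_deg_neg (i : Γ) : sign (-i) = sign i := by
  simp [sign]

lemma sign_add_one (i : Γ) : sign (i + one) = - sign i := by
  simp [sign_add, sign_deg_one]

@[simp] lemma sign_deg_mul_self (i : Γ) : sign i * sign i = 1 := Int.units_mul_self _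

end GradingDatum

open GradingDatum

/-- A DG-category: a category enriched in `Γ`-graded complexes of abelian groups.
The group of morphisms of degree `i` is `Hom X Y i`. The degrees of composites and of differentials
are carried by explicit equations, to avoid transport along equalities of degrees.
`comp g f _` is the composite `g ∘ f`. -/
class DGCategory (Γ : Type w) [AddCommGroup Γ] [GradingDatum Γ] (C : Type u) where
  Hom : C → C → Γ → Type v
  [addCommGroup : ∀ X Y i, AddCommGroup (Hom X Y i)]
  d : ∀ {X Y : C} (i j : Γ), i + one = j → (Hom X Y i →+ Hom X Y j)
  comp : ∀ {X Y Z : C} {i j k : Γ}, Hom Y Z i → Hom X Y j → i + j = k → Hom X Z k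
  id : ∀ X : C, Hom X X 0
  d_d : ∀ {X Y : C} {i j k : Γ} (hij : i + one = j) (hjk : j + one = k) (f : Hom X Y i),
    d j k hjk (d i j hij f) = 0
  add_comp : ∀ {X Y Z : C} {i j k : Γ} (g g' : Hom Y Z i) (f : Hom X Y j) (h : i + j = k),
    comp (g + g') f h = comp g f h + comp g' f h
  comp_add : ∀ {X Y Z : C} {i j k : Γ} (g : Hom Y Z i) (f f' : Hom X Y j) (h : i + j = k),
    comp g (f + f') h = comp g f h + comp g f' h
  assoc : ∀ {X Y Z W : C} {i j k ij jk ijk : Γ} (h : Hom Z W i) (g : Hom Y Z j) (f : Hom X Y k)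
    (hij : i + j = ij) (hjk : j + k = jk) (h₁ : ij + k = ijk) (h₂ : i + jk = ijk),
    comp (comp h g hij) f h₁ = comp h (comp g f hjk) h₂
  id_comp : ∀ {X Y : C} {i : Γ} (f : Hom X Y i), comp (id Y) f (zero_add i) = f
  comp_id : ∀ {X Y : C} {i : Γ} (f : Hom X Y i), comp f (id X) (add_zero i) = f
  leibniz : ∀ {X Y Z : C} {i j k i' j' k' : Γ} (g : Hom Y Z i) (f : Hom X Y j) (h : i + j = k)
    (hi : i + one = i') (hj : j + one = j') (hk : k + one = k')
    (h₁ : i' + j = k') (h₂ : i + j' = k'),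
    d k k' hk (comp g f h) = comp (d i i' hi g) f h₁ + sign i • comp g (d j j' hj f) h₂
  d_id : ∀ X : C, d 0 (0 + one) rfl (id X) = 0

attribute [reducible, instance] DGCategory.addCommGroup

namespace DGCategory

section basic

variable {Γ : Type w} [AddCommGroup Γ] [GradingDatum Γ] {C : Type u} [DGCategory.{w, v, u} Γ C]

/-- Transport of a morphism along an equality of degrees. -/
def dcast {X Y : C} {i j : Γ} (h : i = j) : Hom X Y i →+ Hom X Y j where
  toFun f := h ▸ f
  map_zero' := by subst h; rfl
  map_add' _ _ := by subst h; rfl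

@[simp] lemma dcast_rfl {X Y : C} {i : Γ} (h : i = i) (f : Hom X Y i) : dcast h f = f := rfl

@[simp] lemma dcast_dcast {X Y : C} {i j k : Γ} (h : i = j) (h' : j = k) (f : Hom X Y i) :
    dcast h' (dcast h f) = dcast (h.trans h') f := by
  subst h h'; rfl

lemma comp_dcast {X Y Z : C} {i j j' k : Γ} (g : Hom Y Z i) (f : Hom X Y j) (e : j = j')
    (h : i + j' = k) : comp g (dcast e f) h = comp g f (e ▸ h) := by
  subst e; rfl

lemma dcast_comp_left {X Y Z : C} {i i' j k : Γ} (g : Hom Y Z i) (f : Hom X Y j) (e : i = i')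
    (h : i' + j = k) : comp (dcast e g) f h = comp g f (e ▸ h) := by
  subst e; rfl

lemma dcast_comp {X Y Z : C} {i j k k' : Γ} (g : Hom Y Z i) (f : Hom X Y j) (h : i + j = k)
    (e : k = k') : dcast e (comp g f h) = comp g f (h.trans e) := by
  subst e; rfl

lemma d_dcast {X Y : C} {i i' j : Γ} (e : i = i') (h : i' + one = j) (f : Hom X Y i) :
    d i' j h (dcast e f) = d i j (e ▸ h) f := by
  subst e; rfl

lemma cast_d {X Y : C} {i j j' : Γ} (h : i + one = j) (e : j = j') (f : Hom X Y i) :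
    dcast e (d i j h f) = d i j' (h.trans e) f := by
  subst e; rfl

lemma d_eq_zero_iff {X Y : C} {i j j' : Γ} (h : i + one = j) (h' : i + one = j')
    (f : Hom X Y i) : d i j h f = 0 ↔ d i j' h' f = 0 := by
  subst h h'; rfl

@[simp] lemma zero_dcomp {X Y Z : C} {i j k : Γ} (f : Hom X Y j) (h : i + j = k) :
    comp (0 : Hom Y Z i) f h = 0 := by
  have := add_comp (0 : Hom Y Z i) 0 f h
  simpa using this

@[simp] lemma dcomp_zero {X Y Z : C} {i j k : Γ} (g : Hom Y Z i) (h : i + j = k) :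
    comp g (0 : Hom X Y j) h = 0 := by
  have := comp_add g (0 : Hom X Y j) 0 h
  simpa using this

lemma neg_comp {X Y Z : C} {i j k : Γ} (g : Hom Y Z i) (f : Hom X Y j) (h : i + j = k) :
    comp (-g) f h = - comp g f h := by
  rw [eq_neg_iff_add_eq_zero, ← add_comp]; simp

lemma comp_neg {X Y Z : C} {i j k : Γ} (g : Hom Y Z i) (f : Hom X Y j) (h : i + j = k) :
    comp g (-f) h = - comp g f h := by
  rw [eq_neg_iff_add_eq_zero, ← comp_add]; simp

lemma sub_comp {X Y Z : C} {i j k : Γ} (g g' : Hom Y Z i) (f : Hom X Y j) (h : i + j = k) :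
    comp (g - g') f h = comp g f h - comp g' f h := by
  rw [sub_eq_add_neg, sub_eq_add_neg, add_comp, neg_comp]

lemma comp_sub {X Y Z : C} {i j k : Γ} (g : Hom Y Z i) (f f' : Hom X Y j) (h : i + j = k) :
    comp g (f - f') h = comp g f h - comp g f' h := by
  rw [sub_eq_add_neg, sub_eq_add_neg, comp_add, comp_neg]

lemma smul_comp {X Y Z : C} {i j k : Γ} (u : ℤˣ) (g : Hom Y Z i) (f : Hom X Y j)
    (h : i + j = k) : comp (u • g) f h = u • comp g f h := by
  rcases Int.units_eq_one_or u with rfl | rfl <;> simp [Units.smul_def, neg_comp]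

lemma comp_smul {X Y Z : C} {i j k : Γ} (u : ℤˣ) (g : Hom Y Z i) (f : Hom X Y j)
    (h : i + j = k) : comp g (u • f) h = u • comp g f h := by
  rcases Int.units_eq_one_or u with rfl | rfl <;> simp [Units.smul_def, comp_neg]

lemma d_smul {X Y : C} {i j : Γ} (u : ℤˣ) (f : Hom X Y i) (h : i + one = j) :
    d i j h (u • f) = u • d i j h f := by
  rcases Int.units_eq_one_or u with rfl | rfl <;> simp [Units.smul_def]

lemma id_comp' {X Y : C} {i j : Γ} (f : Hom X Y i) (h : 0 + i = j) :
    comp (id Y) f h = dcast ((zero_add i).symm.trans h) f := by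
  obtain rfl : i = j := (zero_add i).symm.trans h
  exact id_comp f

lemma comp_id' {X Y : C} {i j : Γ} (f : Hom X Y i) (h : i + 0 = j) :
    comp f (id X) h = dcast ((add_zero i).symm.trans h) f := by
  obtain rfl : i = j := (add_zero i).symm.trans h
  exact comp_id f

lemma d_id' (X : C) {j : Γ} (h : 0 + one = j) : d 0 j h (id X) = 0 := by
  subst h; exact d_id X

/-- Composites of closed morphisms are closed. -/
lemma d_comp_of_closed {X Y Z : C} {i j k i' j' k' : Γ} (g : Hom Y Z i) (f : Hom X Y j)
    (h : i + j = k) (hi : i + one = i') (hj : j + one = j') (hk : k + one = k')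
    (hg : d i i' hi g = 0) (hf : d j j' hj f = 0) : d k k' hk (comp g f h) = 0 := by
  rw [leibniz g f h hi hj hk (by rw [← hi, ← hk, ← h]; abel) (by rw [← hj, ← hk, ← h]; abel),
    hg, hf]
  simp

/-- Composition with the degree of the composite being literally the sum of the degrees. -/
def mul {X Y Z : C} {i j : Γ} (g : Hom Y Z i) (f : Hom X Y j) : Hom X Z (i + j) := comp g f rfl

lemma comp_eq {X Y Z : C} {i j k : Γ} (g : Hom Y Z i) (f : Hom X Y j) (h : i + j = k) :
    comp g f h = dcast h (mul g f) := by
  subst h; rfl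

lemma mul_dcast {X Y Z : C} {i j j' : Γ} (g : Hom Y Z i) (f : Hom X Y j) (e : j = j') :
    mul g (dcast e f) = dcast (by rw [e]) (mul g f) := by
  subst e; rfl

lemma dcast_mul {X Y Z : C} {i i' j : Γ} (g : Hom Y Z i) (f : Hom X Y j) (e : i = i') :
    mul (dcast e g) f = dcast (by rw [e]) (mul g f) := by
  subst e; rfl

lemma mul_mul {X Y Z W : C} {i j k : Γ} (h : Hom Z W i) (g : Hom Y Z j) (f : Hom X Y k) :
    mul (mul h g) f = dcast (add_assoc i j k).symm (mul h (mul g f)) := by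
  rw [← comp_eq]; exact DGCategory.assoc _ _ _ _ _ _ _

lemma id_mul {X Y : C} {i : Γ} (f : Hom X Y i) :
    mul (id Y) f = dcast (zero_add i).symm f := id_comp' f _

lemma mul_id {X Y : C} {i : Γ} (f : Hom X Y i) :
    mul f (id X) = dcast (add_zero i).symm f := comp_id' f _

lemma mul_dadd {X Y Z : C} {i j : Γ} (g : Hom Y Z i) (f f' : Hom X Y j) :
    mul g (f + f') = mul g f + mul g f' := comp_add _ _ _ _

lemma dadd_mul {X Y Z : C} {i j : Γ} (g g' : Hom Y Z i) (f : Hom X Y j) :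
    mul (g + g') f = mul g f + mul g' f := add_comp _ _ _ _

lemma mul_dsub {X Y Z : C} {i j : Γ} (g : Hom Y Z i) (f f' : Hom X Y j) :
    mul g (f - f') = mul g f - mul g f' := comp_sub _ _ _ _

lemma dsub_mul {X Y Z : C} {i j : Γ} (g g' : Hom Y Z i) (f : Hom X Y j) :
    mul (g - g') f = mul g f - mul g' f := sub_comp _ _ _ _

lemma mul_dsmul {X Y Z : C} {i j : Γ} (u : ℤˣ) (g : Hom Y Z i) (f : Hom X Y j) :
    mul g (u • f) = u • mul g f := comp_smul _ _ _ _

lemma dsmul_mul {X Y Z : C} {i j : Γ} (u : ℤˣ) (g : Hom Y Z i) (f : Hom X Y j) :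
    mul (u • g) f = u • mul g f := smul_comp _ _ _ _

@[simp] lemma mul_dzero {X Y Z : C} {i j : Γ} (g : Hom Y Z i) :
    mul g (0 : Hom X Y j) = 0 := dcomp_zero _ _

@[simp] lemma dzero_mul {X Y Z : C} {i j : Γ} (f : Hom X Y j) :
    mul (0 : Hom Y Z i) f = 0 := zero_dcomp _ _

lemma dcast_dsmul {X Y : C} {i j : Γ} (u : ℤˣ) (f : Hom X Y i) (h : i = j) :
    dcast h (u • f) = u • dcast h f := by
  subst h; rfl

lemma mul_eq_of_comp {X Y Z : C} {i j k : Γ} {g : Hom Y Z i} {f : Hom X Y j} {h : i + j = k}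
    {c : Hom X Z k} (e : comp g f h = c) : mul g f = dcast h.symm c := by
  subst h; exact e

lemma mul_mul_of_comp {W X Y Z : C} {i j k l : Γ} {g : Hom Y Z i} {f : Hom X Y j} {h : i + j = k}
    {c : Hom X Z k} (e : comp g f h = c) (x : Hom W X l) :
    mul g (mul f x) = dcast (by rw [← h, add_assoc]) (mul c x) := by
  subst h e
  change _ = dcast _ (mul (mul g f) x)
  rw [mul_mul, dcast_dcast, dcast_rfl]

end basic

end DGCategory

open DGCategory

/-- The category `Z⁰` of a DG-category: the same objects, closed morphisms of degree `0`. -/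
structure ZZero (Γ : Type w) (C : Type u) where
  obj : C

namespace ZZero

variable {Γ : Type w} [AddCommGroup Γ] [GradingDatum Γ] {C : Type u} [DGCategory.{w, v, u} Γ C]

instance : Category.{v} (ZZero Γ C) where
  Hom X Y := (d (X := X.obj) (Y := Y.obj) (0 : Γ) (0 + one) rfl).ker
  id X := ⟨DGCategory.id X.obj, d_id X.obj⟩
  comp f g := ⟨DGCategory.comp g.1 f.1 (add_zero 0),
    d_comp_of_closed _ _ _ rfl rfl _ g.2 f.2⟩
  id_comp f := Subtype.ext (DGCategory.comp_id f.1)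
  comp_id f := Subtype.ext (DGCategory.id_comp f.1)
  assoc _ _ _ := Subtype.ext (DGCategory.assoc _ _ _ _ _ _ _).symm

/-- A closed morphism of degree `0`, as a morphism in `Z⁰`. -/
def homMk {X Y : ZZero Γ C} (f : DGCategory.Hom X.obj Y.obj (0 : Γ))
    (hf : d 0 (0 + one) rfl f = 0) : X ⟶ Y := ⟨f, hf⟩

/-- The underlying morphism of degree `0` of a morphism in `Z⁰`. -/
def val {X Y : ZZero Γ C} (f : X ⟶ Y) : DGCategory.Hom X.obj Y.obj (0 : Γ) := f.1

lemma d_val {X Y : ZZero Γ C} (f : X ⟶ Y) {j : Γ} (h : 0 + one = j) : d 0 j h (val f) = 0 := by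
  subst h; exact f.2

@[simp] lemma val_homMk {X Y : ZZero Γ C} (f : DGCategory.Hom X.obj Y.obj (0 : Γ))
    (hf : d 0 (0 + one) rfl f = 0) : val (homMk f hf) = f := rfl

@[ext] lemma hom_ext {X Y : ZZero Γ C} {f g : X ⟶ Y} (h : val f = val g) : f = g := Subtype.ext h

@[simp] lemma val_id (X : ZZero Γ C) : val (𝟙 X) = DGCategory.id X.obj := rfl

@[simp] lemma val_comp {X Y Z : ZZero Γ C} (f : X ⟶ Y) (g : Y ⟶ Z) :
    val (f ≫ g) = DGCategory.comp (val g) (val f) (add_zero 0) := rfl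

instance : Preadditive (ZZero Γ C) where
  homGroup X Y := inferInstanceAs
    (AddCommGroup (d (X := X.obj) (Y := Y.obj) (0 : Γ) (0 + one) rfl).ker)
  add_comp _ _ _ _ _ _ := Subtype.ext (DGCategory.comp_add _ _ _ _)
  comp_add _ _ _ _ _ _ := Subtype.ext (DGCategory.add_comp _ _ _ _)

@[simp] lemma val_add {X Y : ZZero Γ C} (f g : X ⟶ Y) : val (f + g) = val f + val g := rfl

end ZZero

/-- The structure of a shift of `X` by `[i]` on an object `Y`. -/
structure ShiftData {Γ : Type w} [AddCommGroup Γ] [GradingDatum Γ] {C : Type u}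
    [DGCategory.{w, v, u} Γ C] (i : Γ) (X Y : C) where
  hom : Hom X Y (-i)
  inv : Hom Y X i
  hom_inv : comp hom inv (neg_add_cancel i) = DGCategory.id Y
  inv_hom : comp inv hom (add_neg_cancel i) = DGCategory.id X
  d_hom : d (-i) (-i + one) rfl hom = 0

lemma ShiftData.d_inv {Γ : Type w} [AddCommGroup Γ] [GradingDatum Γ] {C : Type u}
    [DGCategory.{w, v, u} Γ C] {i : Γ} {X Y : C} (s : ShiftData i X Y) {j : Γ} (h : i + one = j) :
    d i j h s.inv = 0 := by
  have h1 := leibniz s.hom s.inv (neg_add_cancel i) rfl h rfl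
    (by abel) (by rw [← h]; abel)
  rw [s.hom_inv, d_id, s.d_hom, zero_dcomp] at h1
  have h2 : comp s.hom (d i j h s.inv) (by rw [← h]; abel : -i + j = 0 + one) = 0 := by
    have := congrArg (fun x => sign (-i) • x) h1
    simpa [smul_smul] using this.symm
  have h3 := DGCategory.assoc s.inv s.hom (d i j h s.inv) (add_neg_cancel i)
    (by rw [← h]; abel : -i + j = 0 + one) (zero_add j) (by rw [← h]; abel)
  rwa [s.inv_hom, DGCategory.id_comp, h2, dcomp_zero] at h3

/-- A DG-category with (chosen) shifts: every object has a shift by every degree `i : Γ`. -/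
class HasShifts (Γ : Type w) [AddCommGroup Γ] [GradingDatum Γ] (C : Type u)
    [DGCategory.{w, v, u} Γ C] where
  shift : Γ → C → C
  data : ∀ (i : Γ) (X : C), ShiftData i X (shift i X)

/-- The structure of a cone of a closed morphism `f : X ⟶ Y` of degree `0` on an object `K`:
the closed morphisms `ι : Y ⟶ K` of degree `0` and `π : K ⟶ X` of degree `1`, and the morphisms
`π' : K ⟶ Y` of degree `0` and `ι' : X ⟶ K` of degree `-1`, which make `K` the direct sum of `Y`
and `X[1]` as a graded object, with the differential twisted by `f`.
Equivalently, `K` represents the cones of the morphisms of complexes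
`f ∘ - : Hom(Z, X) ⟶ Hom(Z, Y)`, see `ConeData.bijective` and `ConeData.d_compat`. -/
structure ConeData {Γ : Type w} [AddCommGroup Γ] [GradingDatum Γ] {C : Type u}
    [DGCategory.{w, v, u} Γ C] {X Y : ZZero Γ C} (f : X ⟶ Y) (K : C) where
  ι : Hom Y.obj K (0 : Γ)
  π : Hom K X.obj (one : Γ)
  π' : Hom K Y.obj (0 : Γ)
  ι' : Hom X.obj K (-one : Γ)
  π'_ι' : comp π' ι' (zero_add _) = 0
  π_ι : comp π ι (add_zero _) = 0
  π'_ι : comp π' ι (add_zero 0) = DGCategory.id Y.obj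
  π_ι' : comp π ι' (add_neg_cancel _) = DGCategory.id X.obj
  sum : comp ι π' (add_zero 0) + comp ι' π (neg_add_cancel _) = DGCategory.id K
  d_ι : d 0 (0 + one) rfl ι = 0
  d_π : d one (one + one) rfl π = 0
  d_π' : d 0 one (zero_add _) π' = - comp (ZZero.val f) π (zero_add _)
  d_ι' : d (-one) 0 (neg_add_cancel _) ι' = comp ι (ZZero.val f) (add_zero 0)

namespace ConeData

variable {Γ : Type w} [AddCommGroup Γ] [GradingDatum Γ] {C : Type u}
    [DGCategory.{w, v, u} Γ C] {X Y : ZZero Γ C} {f : X ⟶ Y} {K : C}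

/-- The components of a morphism into a cone, as an element of the degree `i` term of the cone of
the morphism of complexes `f ∘ - : Hom(Z, X) ⟶ Hom(Z, Y)`. -/
def components (c : ConeData f K) (Z : C) (i : Γ) (h : Hom Z K i) :
    Hom Z X.obj (one + i) × Hom Z Y.obj i :=
  (comp c.π h rfl, comp c.π' h (zero_add i))

lemma bijective (c : ConeData f K) (Z : C) (i : Γ) :
    Function.Bijective (c.components Z i) := by
  have key : ∀ h : Hom Z K i, comp c.ι (c.components Z i h).2 (zero_add i) +
      comp c.ι' (c.components Z i h).1 (neg_add_cancel_left _ _) = h := by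
    intro h
    have e := congrArg (fun t => comp t h (zero_add i)) c.sum
    simp only [DGCategory.add_comp, DGCategory.id_comp] at e
    rw [DGCategory.assoc c.ι c.π' h _ (zero_add i) _ (zero_add i),
      DGCategory.assoc c.ι' c.π h _ rfl _ (neg_add_cancel_left _ _)] at e
    exact e
  refine ⟨fun h h' e => by rw [← key h, ← key h', e], fun p => ?_⟩
  refine ⟨comp c.ι p.2 (zero_add i) + comp c.ι' p.1 (neg_add_cancel_left _ _), ?_⟩
  refine Prod.ext ?_ ?_
  · simp only [components, DGCategory.comp_add]
    rw [← DGCategory.assoc c.π c.ι p.2 (add_zero _) (zero_add i) rfl rfl,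
      ← DGCategory.assoc c.π c.ι' p.1 (add_neg_cancel _) (neg_add_cancel_left _ _) (zero_add _) rfl,
      c.π_ι, c.π_ι', zero_dcomp, DGCategory.id_comp, zero_add]
  · simp only [components, DGCategory.comp_add]
    rw [← DGCategory.assoc c.π' c.ι p.2 (add_zero _) (zero_add i) (zero_add i) (zero_add i),
      ← DGCategory.assoc c.π' c.ι' p.1 (zero_add _) (neg_add_cancel_left _ _)
        (neg_add_cancel_left _ _) (zero_add i),
      c.π'_ι, c.π'_ι', zero_dcomp, DGCategory.id_comp, add_zero]

/-- The bijections `components` identify the differential with that of the cone of the morphism of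
complexes `f ∘ -`, which takes `(x, y)` to `(-d x, f ∘ x + d y)`. -/
lemma d_compat (c : ConeData f K) (Z : C) (i : Γ) (h : Hom Z K i) :
    c.components Z (one + i) (d i (one + i) (add_comm _ _) h) =
      (- d (one + i) (one + (one + i)) (add_comm _ _) (c.components Z i h).1,
        comp (ZZero.val f) (c.components Z i h).1 (zero_add _) +
          d i (one + i) (add_comm _ _) (c.components Z i h).2) := by
  refine Prod.ext ?_ ?_
  · simp only [components]
    rw [leibniz c.π h rfl rfl (add_comm _ _) (add_comm _ _) (by abel) rfl, c.d_π, zero_dcomp,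
      zero_add, sign_deg_one]
    simp [Units.smul_def]
  · simp only [components]
    rw [leibniz c.π' h (zero_add i) (zero_add _) (add_comm _ _) (add_comm _ _) rfl (zero_add _),
      c.d_π', neg_comp, sign_deg_zero, one_smul,
      DGCategory.assoc (ZZero.val f) c.π h (zero_add _) rfl rfl (zero_add _)]
    abel

end ConeData

/-- A DG-category with (chosen) cones of all closed morphisms of degree `0`. -/
class HasCones (Γ : Type w) [AddCommGroup Γ] [GradingDatum Γ] (C : Type u)
    [DGCategory.{w, v, u} Γ C] where
  cone : ∀ {X Y : ZZero Γ C}, (X ⟶ Y) → C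
  data : ∀ {X Y : ZZero Γ C} (f : X ⟶ Y), ConeData f (cone f)

namespace ZZero

variable {Γ : Type w} [AddCommGroup Γ] [GradingDatum Γ] (C : Type u) [DGCategory.{w, v, u} Γ C]

/-- The shift functor `[i]` on `Z⁰`: on morphisms, conjugation by the closed isomorphisms
`X ⟶ X[i]` of degree `-i`. -/
def shiftFunctor [HasShifts Γ C] (i : Γ) : ZZero Γ C ⥤ ZZero Γ C where
  obj X := ⟨HasShifts.shift i X.obj⟩
  map {X Y} f := homMk
    (comp (comp (HasShifts.data i Y.obj).hom (val f) (add_zero _))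
      (HasShifts.data i X.obj).inv (neg_add_cancel i))
    (d_comp_of_closed _ _ _ rfl rfl _
      (d_comp_of_closed _ _ _ rfl rfl _ (HasShifts.data i Y.obj).d_hom (d_val f rfl))
      ((HasShifts.data i X.obj).d_inv rfl))
  map_id X := by
    ext
    simp only [val_homMk, val_id]
    rw [DGCategory.comp_id]
    exact (HasShifts.data i X.obj).hom_inv
  map_comp {X Y Z} f g := by
    ext
    simp only [val_homMk, val_comp, comp_eq, mul_dcast, dcast_mul, mul_mul, dcast_dcast,
      mul_mul_of_comp (HasShifts.data i Y.obj).inv_hom, id_mul]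

instance [HasShifts Γ C] (i : Γ) : (shiftFunctor C i).Additive where
  map_add {X Y f g} := by
    ext
    simp only [shiftFunctor, val_homMk, val_add, DGCategory.comp_add, DGCategory.add_comp]
    rfl

end ZZero

/-- An object of `C^♮`: an object of `C` with a contracting homotopy of zero square. -/
structure Bec (Γ : Type w) [AddCommGroup Γ] [GradingDatum Γ] (C : Type u)
    [DGCategory.{w, v, u} Γ C] where
  obj : C
  σ : Hom obj obj (-one : Γ)
  d_σ : d (-one) 0 (neg_add_cancel _) σ = DGCategory.id obj
  σ_σ : comp σ σ (rfl : (-one : Γ) + -one = -one + -one) = 0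

namespace Bec

variable {Γ : Type w} [AddCommGroup Γ] [GradingDatum Γ] {C : Type u} [DGCategory.{w, v, u} Γ C]

/-- The group of morphisms of degree `i` in `C^♮`: closed morphisms of degree `-i` in `C`. -/
abbrev HomGroup (X Y : Bec Γ C) (i : Γ) : AddSubgroup (Hom X.obj Y.obj (-i)) :=
  (d (X := X.obj) (Y := Y.obj) (-i) (-i + one) rfl).ker

lemma d_coe {X Y : Bec Γ C} {i j : Γ} (f : HomGroup X Y i) (h : -i + one = j) :
    d (-i) j h f.1 = 0 := by
  subst h; exact f.2

lemma coe_units_smul {X Y : Bec Γ C} {i : Γ} (u : ℤˣ) (f : HomGroup X Y i) :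
    ((u • f : HomGroup X Y i) : Hom X.obj Y.obj (-i)) = u • f.1 := by
  rcases Int.units_eq_one_or u with rfl | rfl <;> simp [Units.smul_def]

/-- The graded commutator `f ↦ σ f - (-1)^i f σ`. -/
def commutator {X Y : Bec Γ C} (i j : Γ) (h : i + one = j) :
    Hom X.obj Y.obj (-i) →+ Hom X.obj Y.obj (-j) where
  toFun f := comp Y.σ f (by rw [← h]; abel) - sign i • comp f X.σ (by rw [← h]; abel)
  map_zero' := by simp
  map_add' f g := by simp only [DGCategory.comp_add, DGCategory.add_comp, smul_add]; abel

lemma d_commutator {X Y : Bec Γ C} (i j : Γ) (h : i + one = j) (f : Hom X.obj Y.obj (-i))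
    (hf : d (-i) (-i + one) rfl f = 0) : d (-j) (-j + one) rfl (commutator i j h f) = 0 := by
  obtain rfl := h
  simp only [commutator, AddMonoidHom.coe_mk, ZeroHom.coe_mk, map_sub, d_smul]
  rw [leibniz Y.σ f _ (neg_add_cancel _) rfl rfl (by abel) (by abel),
    leibniz f X.σ _ rfl (neg_add_cancel _) rfl (by abel) (by abel), hf, Y.d_σ, X.d_σ]
  simp [smul_smul, id_comp', comp_id']

/-- The DG-category `C^♮`, with the differential given by the graded commutator with `σ`. -/
instance : DGCategory.{w, v, max u v} Γ (Bec Γ C) where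
  Hom X Y i := HomGroup X Y i
  d {X Y} i j h :=
    { toFun := fun f => ⟨commutator i j h f.1, d_commutator i j h f.1 f.2⟩
      map_zero' := Subtype.ext (map_zero _)
      map_add' := fun _ _ => Subtype.ext (map_add _ _ _) }
  comp {X Y Z i j k} g f h := ⟨DGCategory.comp g.1 f.1 (by rw [← h]; abel),
    d_comp_of_closed _ _ _ rfl rfl _ g.2 f.2⟩
  id X := ⟨dcast neg_zero.symm (DGCategory.id X.obj), by
    change d _ _ _ _ = 0
    rw [d_dcast, d_id']⟩
  d_d {X Y i j k} hij hjk f := by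
    apply Subtype.ext
    obtain rfl := hij
    obtain rfl := hjk
    simp only [commutator, AddMonoidHom.coe_mk, ZeroHom.coe_mk, comp_eq, mul_dsub, dsub_mul, mul_dsmul, dsmul_mul, map_sub, smul_sub,
      smul_smul, dcast_dsmul, mul_dcast, dcast_mul, mul_mul, dcast_dcast, mul_eq_of_comp X.σ_σ,
      mul_mul_of_comp Y.σ_σ, sign_add_one]
    simp
  add_comp _ _ _ _ := Subtype.ext (DGCategory.add_comp _ _ _ _)
  comp_add _ _ _ _ := Subtype.ext (DGCategory.comp_add _ _ _ _)
  assoc _ _ _ _ _ _ _ := Subtype.ext (DGCategory.assoc _ _ _ _ _ _ _)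
  id_comp f := Subtype.ext (by simp [dcast_comp_left, id_comp'])
  comp_id f := Subtype.ext (by simp [comp_dcast, comp_id'])
  leibniz {X Y Z i j k i' j' k'} g f h hi hj hk h₁ h₂ := by
    apply Subtype.ext
    obtain rfl := hi
    obtain rfl := hj
    obtain rfl := hk
    obtain rfl := h
    simp only [commutator, AddMonoidHom.coe_mk, ZeroHom.coe_mk, AddSubgroup.coe_add, coe_units_smul,
      comp_eq, mul_dsub, dsub_mul, mul_dsmul, dsmul_mul, map_sub, smul_sub,
      smul_smul, dcast_dsmul, mul_dcast, dcast_mul, mul_mul, dcast_dcast, sign_add]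
    abel
  d_id X := by
    apply Subtype.ext
    simp [commutator, comp_dcast, dcast_comp_left, comp_id', id_comp']

end Bec

namespace Bec

variable {Γ : Type w} [AddCommGroup Γ] [GradingDatum Γ] {C : Type u} [DGCategory.{w, v, u} Γ C]

/-- The shift by `[i]` of an object of `C^♮`, induced by the shift by `[-i]` in `C`. -/
def shiftObj [HasShifts Γ C] (i : Γ) (X : Bec Γ C) : Bec Γ C where
  obj := HasShifts.shift (-i) X.obj
  σ := sign i • comp (comp (HasShifts.data (-i) X.obj).hom X.σ rfl)
    (HasShifts.data (-i) X.obj).inv (by abel)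
  d_σ := by
    rw [d_smul, leibniz (comp (HasShifts.data (-i) X.obj).hom X.σ rfl)
      (HasShifts.data (-i) X.obj).inv _ rfl rfl _ (by abel) (by abel),
      (HasShifts.data (-i) X.obj).d_inv,
      leibniz (HasShifts.data (-i) X.obj).hom X.σ _ rfl (neg_add_cancel _) _ (by abel) (by abel),
      (HasShifts.data (-i) X.obj).d_hom, X.d_σ]
    simp only [zero_dcomp, dcomp_zero, smul_zero, add_zero, zero_add, smul_comp, smul_smul,
      sign_deg_neg, sign_deg_mul_self, one_smul, comp_id', dcast_comp_left]
    exact (HasShifts.data (-i) X.obj).hom_inv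
  σ_σ := by
    simp only [comp_eq, mul_dsmul, dsmul_mul, smul_smul, dcast_dsmul, mul_dcast, dcast_mul, mul_mul,
      dcast_dcast, mul_mul_of_comp (HasShifts.data (-i) X.obj).inv_hom, id_mul,
      mul_mul_of_comp X.σ_σ]
    simp

lemma shift_comm (i : Γ) (X : Bec Γ C) (Y : C) (s : ShiftData (-i) X.obj Y)
    (h₁ : -(-i) + -one + -i = -one) {k : Γ} (h₂ : -one + -(-i) = k) (h₃ : -(-i) + -one = k) :
    comp (sign i • comp (comp s.hom X.σ rfl) s.inv h₁) s.hom h₂ =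
      sign (-i) • comp s.hom X.σ h₃ := by
  subst h₃
  simp only [comp_eq, dsmul_mul, dcast_dsmul, mul_dcast, dcast_mul, mul_mul, dcast_dcast,
    mul_eq_of_comp s.inv_hom, mul_id, sign_deg_neg]

instance [HasShifts Γ C] : HasShifts Γ (Bec Γ C) where
  shift i X := shiftObj i X
  data i X :=
    { hom := ⟨(HasShifts.data (-i) X.obj).hom, (HasShifts.data (-i) X.obj).d_hom⟩
      inv := ⟨(HasShifts.data (-i) X.obj).inv, (HasShifts.data (-i) X.obj).d_inv rfl⟩
      hom_inv := by
        apply Subtype.ext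
        change comp (HasShifts.data (-i) X.obj).hom (HasShifts.data (-i) X.obj).inv _ =
          dcast _ (DGCategory.id _)
        rw [← (HasShifts.data (-i) X.obj).hom_inv, dcast_comp]
      inv_hom := by
        apply Subtype.ext
        change comp (HasShifts.data (-i) X.obj).inv (HasShifts.data (-i) X.obj).hom _ =
          dcast _ (DGCategory.id _)
        rw [← (HasShifts.data (-i) X.obj).inv_hom, dcast_comp]
      d_hom := by
        apply Subtype.ext
        exact sub_eq_zero.2 (shift_comm _ _ _ (HasShifts.data (-i) X.obj) _ _ _) }

end Bec

/-- The data of morphisms exhibiting an object as `cone(id_A[-1])`, normalized by means of the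
shift isomorphism between `A` and `A[-1]`. -/
structure XiData {Γ : Type w} [AddCommGroup Γ] [GradingDatum Γ] {C : Type u}
    [DGCategory.{w, v, u} Γ C] (A E : C) where
  ι : Hom A E (one : Γ)
  π : Hom E A (0 : Γ)
  π' : Hom E A (-one : Γ)
  ι' : Hom A E (0 : Γ)
  π'_ι' : comp π' ι' (add_zero _) = 0
  π_ι : comp π ι (zero_add _) = 0
  π'_ι : comp π' ι (neg_add_cancel _) = DGCategory.id A
  π_ι' : comp π ι' (add_zero _) = DGCategory.id A
  sum : comp ι π' (add_neg_cancel _) + comp ι' π (add_zero 0) = DGCategory.id E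
  d_ι : d one (one + one) rfl ι = 0
  d_π : d 0 (0 + one) rfl π = 0
  d_π' : d (-one) 0 (neg_add_cancel _) π' = π
  d_ι' : d 0 one (zero_add _) ι' = ι

namespace XiData

variable {Γ : Type w} [AddCommGroup Γ] [GradingDatum Γ] {C : Type u} [DGCategory.{w, v, u} Γ C]

/-- The normalized data of morphisms for the cone `E` of the identity of a shift `B = A[-1]`. -/
def ofCone {A B : C} (s : ShiftData (-one : Γ) A B) {E : C}
    (c : ConeData (𝟙 (⟨B⟩ : ZZero Γ C)) E) : XiData (Γ := Γ) A E where
  ι := comp c.ι s.hom (by simp)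
  π := comp s.inv c.π (neg_add_cancel _)
  π' := comp s.inv c.π' (add_zero _)
  ι' := comp c.ι' s.hom (by simp)
  π'_ι' := by
    simp only [comp_eq, mul_dcast, dcast_mul, mul_mul, dcast_dcast, mul_mul_of_comp c.π'_ι']
    simp
  π_ι := by
    simp only [comp_eq, mul_dcast, dcast_mul, mul_mul, dcast_dcast, mul_mul_of_comp c.π_ι]
    simp
  π'_ι := by
    simp only [comp_eq, mul_dcast, dcast_mul, mul_mul, dcast_dcast, mul_mul_of_comp c.π'_ι,
      id_mul, mul_eq_of_comp s.inv_hom, dcast_rfl]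
  π_ι' := by
    simp only [comp_eq, mul_dcast, dcast_mul, mul_mul, dcast_dcast, mul_mul_of_comp c.π_ι',
      id_mul, mul_eq_of_comp s.inv_hom, dcast_rfl]
  sum := by
    rw [← c.sum]
    simp only [comp_eq, mul_dcast, dcast_mul, mul_mul, dcast_dcast, mul_mul_of_comp s.hom_inv,
      id_mul]
  d_ι := d_comp_of_closed _ _ _ rfl rfl _ c.d_ι s.d_hom
  d_π := d_comp_of_closed _ _ _ rfl rfl _ (s.d_inv rfl) c.d_π
  d_π' := by
    rw [leibniz s.inv c.π' _ (neg_add_cancel _) (zero_add _) _ (by abel) (by abel), s.d_inv,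
      c.d_π', sign_deg_neg, sign_deg_one, ZZero.val_id]
    simp [Units.smul_def, comp_neg, id_comp']
  d_ι' := by
    rw [leibniz c.ι' s.hom _ (neg_add_cancel _) rfl _ (by abel) (by abel), s.d_hom,
      c.d_ι', ZZero.val_id]
    simp [comp_id']

lemma ofCone_π_ι {A B : C} (s : ShiftData (-one : Γ) A B) {E : C}
    (c : ConeData (𝟙 (⟨B⟩ : ZZero Γ C)) E) : comp (ofCone s c).π c.ι (add_zero _) = 0 := by
  simp only [ofCone, comp_eq, mul_dcast, dcast_mul, mul_mul, dcast_dcast, mul_eq_of_comp c.π_ι]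
  simp

/-- The morphism `E_A ⟶ E_B` induced by a morphism `f : A ⟶ B`. -/
def mapHom {A B EA EB : C} (a : XiData (Γ := Γ) A EA) (b : XiData (Γ := Γ) B EB)
    (f : Hom A B (0 : Γ)) : Hom EA EB (0 : Γ) :=
  comp (comp b.ι f (add_zero _)) a.π' (add_neg_cancel _) +
    comp (comp b.ι' f (add_zero _)) a.π (add_zero _)

lemma mapHom_id {A E : C} (a : XiData (Γ := Γ) A E) :
    mapHom a a (DGCategory.id A) = DGCategory.id E := by
  simp only [mapHom, DGCategory.comp_id, a.sum]

lemma mapHom_comp {A B D EA EB ED : C} (a : XiData (Γ := Γ) A EA) (b : XiData (Γ := Γ) B EB)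
    (e : XiData (Γ := Γ) D ED) (g : Hom B D (0 : Γ)) (f : Hom A B (0 : Γ)) :
    mapHom a e (comp g f (add_zero 0)) = comp (mapHom b e g) (mapHom a b f) (add_zero 0) := by
  simp only [mapHom, comp_eq, mul_dcast, dcast_mul, mul_mul, dcast_dcast, mul_dadd, dadd_mul,
    map_add, mul_mul_of_comp b.π'_ι', mul_mul_of_comp b.π_ι, mul_mul_of_comp b.π'_ι,
    mul_mul_of_comp b.π_ι', id_mul, dzero_mul, mul_dzero, map_zero, add_zero, zero_add]

lemma mapHom_add {A B EA EB : C} (a : XiData (Γ := Γ) A EA) (b : XiData (Γ := Γ) B EB)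
    (f g : Hom A B (0 : Γ)) : mapHom a b (f + g) = mapHom a b f + mapHom a b g := by
  simp only [mapHom, DGCategory.comp_add, DGCategory.add_comp]; abel

lemma d_mapHom {A B EA EB : C} (a : XiData (Γ := Γ) A EA) (b : XiData (Γ := Γ) B EB)
    (f : Hom A B (0 : Γ)) (hf : d 0 (0 + one) rfl f = 0) {j : Γ} (h : 0 + one = j) :
    d 0 j h (mapHom a b f) = 0 := by
  have hf' : d 0 j h f = 0 := by subst h; exact hf
  have hj : j = one := by rw [← h, zero_add]
  subst hj
  rw [mapHom, map_add,
    leibniz (comp b.ι f _) a.π' _ rfl (neg_add_cancel _) _ (by abel) (by abel),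
    leibniz (comp b.ι' f _) a.π _ (zero_add _) (zero_add _) _ (by abel) (by abel),
    leibniz b.ι f _ rfl (zero_add _) _ (by abel) (by abel),
    leibniz b.ι' f _ (zero_add _) (zero_add _) _ (by abel) (by abel),
    b.d_ι, a.d_π', b.d_ι', hf', (d_eq_zero_iff rfl (zero_add _) a.π).1 a.d_π]
  simp [sign_deg_one, Units.smul_def]

/-- The contracting homotopy `σ = ι' π'`. -/
def bec {A E : C} (a : XiData (Γ := Γ) A E) : Bec Γ C where
  obj := E
  σ := comp a.ι' a.π' (zero_add _)
  d_σ := by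
    rw [leibniz a.ι' a.π' _ (zero_add _) (neg_add_cancel _) _ (by abel) (by abel), a.d_ι', a.d_π']
    simpa using a.sum
  σ_σ := by
    simp only [comp_eq, mul_dcast, dcast_mul, mul_mul, dcast_dcast, mul_mul_of_comp a.π'_ι']
    simp

lemma d_dcast_mapHom {A B EA EB : C} (a : XiData (Γ := Γ) A EA) (b : XiData (Γ := Γ) B EB)
    (f : Hom A B (0 : Γ)) (hf : d 0 (0 + one) rfl f = 0) :
    d (-0) (-0 + one) rfl (dcast neg_zero.symm (mapHom a b f)) = 0 := by
  rw [d_dcast, d_mapHom _ _ _ hf]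

lemma σ_mapHom {A B EA EB : C} (a : XiData (Γ := Γ) A EA) (b : XiData (Γ := Γ) B EB)
    (f : Hom A B (0 : Γ)) {k : Γ} (h₁ : -one + -0 = k) (h₂ : -0 + -one = k) :
    comp (comp b.ι' b.π' (zero_add _)) (dcast neg_zero.symm (mapHom a b f)) h₁ =
      sign (0 : Γ) • comp (dcast neg_zero.symm (mapHom a b f)) (comp a.ι' a.π' (zero_add _)) h₂ := by
  subst h₂
  simp only [mapHom, comp_eq, mul_dcast, dcast_mul, mul_mul, dcast_dcast, mul_dadd, dadd_mul,
    map_add, mul_mul_of_comp b.π'_ι', mul_mul_of_comp b.π'_ι, mul_mul_of_comp a.π_ι',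
    mul_mul_of_comp a.π'_ι', id_mul, dzero_mul, mul_dzero, map_zero, add_zero, zero_add,
    sign_deg_zero, one_smul]

lemma commutator_mapHom {A B EA EB : C} (a : XiData (Γ := Γ) A EA) (b : XiData (Γ := Γ) B EB)
    (f : Hom A B (0 : Γ)) :
    Bec.commutator (X := a.bec) (Y := b.bec) 0 (0 + one) rfl
      (dcast neg_zero.symm (mapHom a b f)) = 0 := by
  exact sub_eq_zero.2 (σ_mapHom a b f _ _)

lemma dcast_mapHom_comp {A B D EA EB ED : C} (a : XiData (Γ := Γ) A EA) (b : XiData (Γ := Γ) B EB)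
    (e : XiData (Γ := Γ) D ED) (g : Hom B D (0 : Γ)) (f : Hom A B (0 : Γ)) :
    dcast neg_zero.symm (mapHom a e (comp g f (add_zero 0))) =
      comp (dcast neg_zero.symm (mapHom b e g)) (dcast neg_zero.symm (mapHom a b f))
        (by simp) := by
  rw [mapHom_comp a b, dcast_comp_left, comp_dcast, dcast_comp]

end XiData

namespace ZZero

variable (Γ : Type w) [AddCommGroup Γ] [GradingDatum Γ] (C : Type u) [DGCategory.{w, v, u} Γ C]
  [HasShifts Γ C] [HasCones Γ C]

variable {Γ C} in
/-- The object `cone(id_A[-1])`. -/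
def xiObj (A : ZZero Γ C) : C := HasCones.cone (𝟙 ((shiftFunctor C (-one)).obj A))

variable {Γ C} in
/-- The structure morphisms of `cone(id_A[-1])`. -/
def xiData (A : ZZero Γ C) : XiData (Γ := Γ) A.obj (xiObj A) :=
  XiData.ofCone (HasShifts.data (-one) A.obj)
    (HasCones.data (𝟙 ((shiftFunctor C (-one)).obj A)))

/-- The functor `Ξ : Z⁰(C) ⥤ Z⁰(C)`, `A ↦ cone(id_A[-1])`. -/
def xi : ZZero Γ C ⥤ ZZero Γ C where
  obj A := ⟨xiObj A⟩
  map {A B} f := homMk (XiData.mapHom (xiData A) (xiData B) (val f))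
    (XiData.d_mapHom _ _ _ f.2 rfl)
  map_id _ := hom_ext (XiData.mapHom_id _)
  map_comp _ _ := hom_ext (XiData.mapHom_comp _ _ _ _ _)

/-- The natural morphism `A[-1] ⟶ Ξ(A)`. -/
def toXi (A : ZZero Γ C) : (shiftFunctor C (-one)).obj A ⟶ (xi Γ C).obj A :=
  homMk (HasCones.data (𝟙 ((shiftFunctor C (-one)).obj A))).ι
    (HasCones.data (𝟙 ((shiftFunctor C (-one)).obj A))).d_ι

/-- The natural morphism `Ξ(A) ⟶ A`. -/
def fromXi (A : ZZero Γ C) : (xi Γ C).obj A ⟶ A := homMk (xiData A).π (xiData A).d_π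

/-- The natural short sequence `A[-1] ⟶ Ξ(A) ⟶ A`. -/
def xiSequence (A : ZZero Γ C) : ShortComplex (ZZero Γ C) :=
  ShortComplex.mk (toXi Γ C A) (fromXi Γ C A) (by
    ext
    exact XiData.ofCone_π_ι _ _)

/-- The functor `Φ : Z⁰(C) ⥤ Z⁰(C^♮)`, taking `A` to `cone(id_A[-1])` with its natural contracting
homotopy, and acting on morphisms as `Ξ`. -/
def phi : ZZero Γ C ⥤ ZZero Γ (Bec Γ C) where
  obj A := ⟨(xiData A).bec⟩
  map {A B} f := homMk (Γ := Γ) (C := Bec Γ C)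
    ⟨dcast neg_zero.symm (XiData.mapHom (xiData A) (xiData B) (val f)), by
      exact XiData.d_dcast_mapHom _ _ _ f.2⟩
    (Subtype.ext (XiData.commutator_mapHom _ _ _))
  map_id A := by
    apply Subtype.ext
    apply Subtype.ext
    exact congrArg (dcast neg_zero.symm) (XiData.mapHom_id _)
  map_comp f g := by
    apply Subtype.ext
    apply Subtype.ext
    exact XiData.dcast_mapHom_comp _ _ _ _ _

instance : (xi Γ C).Additive where
  map_add {_ _ f g} := hom_ext (XiData.mapHom_add _ _ (val f) (val g))

instance : (phi Γ C).Additive where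
  map_add {A B f g} := by
    apply Subtype.ext
    apply Subtype.ext
    exact (congrArg (dcast neg_zero.symm) (XiData.mapHom_add _ _ (val f) (val g))).trans
      (map_add _ _ _)

end ZZero

namespace ZZero

variable (Γ : Type w) [AddCommGroup Γ] [GradingDatum Γ] (C : Type u) [DGCategory.{w, v, u} Γ C]

/-- The functor `Ψ⁺ : Z⁰(C^♮) ⥤ Z⁰(C)`, `(X, σ) ↦ X`. -/
def psiPlus : ZZero Γ (Bec Γ C) ⥤ ZZero Γ C where
  obj X := ⟨X.obj.obj⟩
  map {X Y} f := homMk (dcast neg_zero (val f).1) (by rw [d_dcast, Bec.d_coe])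
  map_id X := by
    ext
    exact dcast_dcast _ _ _
  map_comp {X Y Z} f g := by
    ext
    exact (dcast_comp _ _ _ _).trans
      ((comp_dcast _ _ _ _).trans (dcast_comp_left _ _ _ _)).symm

instance : (psiPlus Γ C).Additive where
  map_add := hom_ext (map_add _ _ _)

end ZZero

/-- A morphism `f` is an admissible monomorphism with respect to a class of short sequences if it
is the first morphism of a sequence in the class. -/
def IsAdmissibleMono {E : Type u} [Category.{v} E] [Preadditive E] (P : ShortComplex E → Prop)
    {X Y : E} (f : X ⟶ Y) : Prop :=
  ∃ (Z : E) (g : Y ⟶ Z) (zero : f ≫ g = 0), P (ShortComplex.mk f g zero)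

/-- A morphism `g` is an admissible epimorphism with respect to a class of short sequences if it
is the second morphism of a sequence in the class. -/
def IsAdmissibleEpi {E : Type u} [Category.{v} E] [Preadditive E] (P : ShortComplex E → Prop)
    {Y Z : E} (g : Y ⟶ Z) : Prop :=
  ∃ (X : E) (f : X ⟶ Y) (zero : f ≫ g = 0), P (ShortComplex.mk f g zero)

/-- An exact category structure (in the sense of Quillen) on a preadditive category `E`: the
category is additive, and is endowed with a class of kernel-cokernel pairs, closed under
isomorphisms (the admissible short exact sequences), satisfying the usual axioms. -/
@[ext]
structure ExactStructure (E : Type u) [Category.{v} E] [Preadditive E] where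
  hasFiniteBiproducts : HasFiniteBiproducts E
  admissible : ShortComplex E → Prop
  isKernel : ∀ S, admissible S → Nonempty (IsLimit (KernelFork.ofι S.f S.zero))
  isCokernel : ∀ S, admissible S → Nonempty (IsColimit (CokernelCofork.ofπ S.g S.zero))
  of_iso : ∀ {S T : ShortComplex E}, (S ≅ T) → admissible S → admissible T
  mono_id : ∀ X : E, IsAdmissibleMono admissible (𝟙 X)
  epi_id : ∀ X : E, IsAdmissibleEpi admissible (𝟙 X)
  mono_comp : ∀ {X Y Z : E} (f : X ⟶ Y) (g : Y ⟶ Z), IsAdmissibleMono admissible f →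
    IsAdmissibleMono admissible g → IsAdmissibleMono admissible (f ≫ g)
  epi_comp : ∀ {X Y Z : E} (f : X ⟶ Y) (g : Y ⟶ Z), IsAdmissibleEpi admissible f →
    IsAdmissibleEpi admissible g → IsAdmissibleEpi admissible (f ≫ g)
  pushout : ∀ {X Y X' : E} (f : X ⟶ Y) (a : X ⟶ X'), IsAdmissibleMono admissible f →
    ∃ (Y' : E) (b : Y ⟶ Y') (f' : X' ⟶ Y'), IsPushout f a b f' ∧ IsAdmissibleMono admissible f'
  pullback : ∀ {Y Z Z' : E} (g : Y ⟶ Z) (c : Z' ⟶ Z), IsAdmissibleEpi admissible g →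
    ∃ (Y' : E) (b : Y' ⟶ Y) (g' : Y' ⟶ Z'), IsPullback b g' g c ∧ IsAdmissibleEpi admissible g'

namespace ExactStructure

/-- An additive functor is exact if it preserves admissible short exact sequences. -/
def Preserves {E : Type*} {F : Type*} [Category* E] [Category* F] [Preadditive E] [Preadditive F]
    (S : ExactStructure E) (T : ExactStructure F) (Θ : E ⥤ F) [Θ.Additive] : Prop :=
  ∀ A : ShortComplex E, S.admissible A → T.admissible (A.map Θ)

/-- An additive functor reflects admissible short exact sequences if any composable pair of
morphisms taken to an admissible short exact sequence is an admissible short exact sequence. -/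
def Reflects {E : Type*} {F : Type*} [Category* E] [Category* F] [Preadditive E] [Preadditive F]
    (S : ExactStructure E) (T : ExactStructure F) (Θ : E ⥤ F) : Prop :=
  ∀ {X Y Z : E} (f : X ⟶ Y) (g : Y ⟶ Z) (zero' : Θ.map f ≫ Θ.map g = 0),
    T.admissible (ShortComplex.mk (Θ.map f) (Θ.map g) zero') →
      ∃ zero : f ≫ g = 0, S.admissible (ShortComplex.mk f g zero)

section DG

variable {Γ : Type w} [AddCommGroup Γ] [GradingDatum Γ] {C : Type u} [DGCategory.{w, v, u} Γ C]
  [HasShifts Γ C]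

/-- The exact structure on `Z⁰(C)` is preserved by the shift functors `[1]` and `[-1]`. -/
def IsShiftStable (S : ExactStructure (ZZero Γ C)) : Prop :=
  S.Preserves S (ZZero.shiftFunctor C (one : Γ)) ∧ S.Preserves S (ZZero.shiftFunctor C (-one : Γ))

/-- An exact structure on `Z⁰(C)` is DG-compatible if it is preserved by the shifts `[1]` and `[-1]`
and all the sequences `A[-1] ⟶ Ξ(A) ⟶ A` are admissible. -/
structure IsDGCompatible [HasCones Γ C] (S : ExactStructure (ZZero Γ C)) : Prop where
  isShiftStable : S.IsShiftStable
  admissible_xiSequence : ∀ A : ZZero Γ C, S.admissible (ZZero.xiSequence Γ C A)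

/-- A pair of exact structures on `Z⁰(C)` and `Z⁰(C^♮)` is `♮`-compatible if both are preserved by
the shifts `[1]` and `[-1]`, and the functors `Φ` and `Ψ⁺` preserve and reflect admissible short
exact sequences. -/
structure IsBecCompatible [HasCones Γ C] (S : ExactStructure (ZZero Γ C))
    (T : ExactStructure (ZZero Γ (Bec Γ C))) : Prop where
  isShiftStable : S.IsShiftStable
  isShiftStable_bec : T.IsShiftStable
  phi_preserves : S.Preserves T (ZZero.phi Γ C)
  phi_reflects : S.Reflects T (ZZero.phi Γ C)
  psiPlus_preserves : T.Preserves S (ZZero.psiPlus Γ C)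
  psiPlus_reflects : T.Reflects S (ZZero.psiPlus Γ C)

end DG

end ExactStructure

/-- The additional structure making a DG-category `C` with shifts and cones into an exact
DG-category: a `♮`-compatible pair of exact structures on `Z⁰(C)` and `Z⁰(C^♮)`. -/
structure ExactDGStructure (Γ : Type w) [AddCommGroup Γ] [GradingDatum Γ] (C : Type u)
    [DGCategory.{w, v, u} Γ C] [HasShifts Γ C] [HasCones Γ C] where
  base : ExactStructure (ZZero Γ C)
  bec : ExactStructure (ZZero Γ (Bec Γ C))
  compatible : base.IsBecCompatible bec

/-! Two facts carry the proof.

The first is that the objects `Ξ(A)` make `Z⁰(C)` see morphisms of all degrees. Closed degree-`0`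
morphisms into `Ξ(A)` are arbitrary degree `-1` morphisms into `A`, and closed degree-`0` morphisms
out of `Ξ(A)` are arbitrary degree-`0` morphisms out of `A`. With shifts, every functor `Hom^i(-,
V)` or `Hom^i(V, -)` is therefore represented on `Z⁰(C)`, so a pushout or pullback in `Z⁰(C)` is
universal for morphisms of every degree, closed or not (`existsUnique_desc`, `existsUnique_lift`).
In particular contracting homotopies pass to it uniquely, and `Ψ⁺` creates pushouts and pullbacks.
Kernels and cokernels are included as the case where one corner is zero. Hence the sequences that
`Ψ⁺` takes to admissible ones form an exact structure `S.bec` on `Z⁰(C^♮)`. As `Ψ⁺` must preserve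
and reflect, it is the only candidate.

The second is that `Ψ⁺ ∘ Φ ≅ Ξ`, so for `S.bec` the conditions on `Φ` say that `Ξ` preserves and
reflects admissible sequences. Let `S` be DG-compatible.

Preservation (`xi_preserves`): for an admissible `X → Y → Z`, the pullback `K` of `Ξ(Y) → Y` along
`X → Y` is also the pushout of `Y[-1] ← X[-1] → Ξ(X)`; both are `cone(f[-1])`. Thus `Ξ(f)` factors
as `Ξ(X) → K → Ξ(Y)`, a pushout of `f[-1]` followed by a kernel of the admissible epimorphism `Ξ(Y)
→ Y → Z`.

Reflection (`xi_reflects`): `Ξ(Y) → Y → Z` equals `Ξ(Y) → Ξ(Z) → Z`, a composite of admissible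
epimorphisms, and a form of Quillen's obscure axiom (`admissible_of_comp_admissibleEpi`) descends
this to `Y → Z`.

Conversely, `Ξ` takes `A[-1] → Ξ(A) → A` to a split sequence, which is admissible in every exact
structure. If `Φ` reflects, the sequence itself is admissible, so the first member of a
`♮`-compatible pair is DG-compatible. -/

/-! ### Kernels and cokernels, as factorization properties and as squares with a zero corner. -/

section KernelCokernel

variable {E : Type u} [Category.{v} E] [Preadditive E] {X Y Z : E} {f : X ⟶ Y} {g : Y ⟶ Z}
  {zero : f ≫ g = 0}

lemma nonempty_isLimit_kernelFork_iff : Nonempty (IsLimit (KernelFork.ofι f zero)) ↔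
    Mono f ∧ ∀ {W : E} (h : W ⟶ Y), h ≫ g = 0 → ∃ k : W ⟶ X, k ≫ f = h := by
  refine ⟨fun ⟨hf⟩ => ⟨mono_of_isLimit_fork hf, fun h w => ?_⟩, fun ⟨_, H⟩ => ?_⟩
  · exact ⟨_, (KernelFork.IsLimit.lift' hf h w).2⟩
  · exact ⟨KernelFork.IsLimit.ofι' f zero fun h w => ⟨(H h w).choose, (H h w).choose_spec⟩⟩

lemma nonempty_isColimit_cokernelCofork_iff :
    Nonempty (IsColimit (CokernelCofork.ofπ g zero)) ↔
    Epi g ∧ ∀ {W : E} (h : Y ⟶ W), f ≫ h = 0 → ∃ k : Z ⟶ W, g ≫ k = h := by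
  refine ⟨fun ⟨hg⟩ => ⟨epi_of_isColimit_cofork hg, fun h w => ?_⟩, fun ⟨_, H⟩ => ?_⟩
  · exact ⟨_, (CokernelCofork.IsColimit.desc' hg h w).2⟩
  · exact ⟨CokernelCofork.IsColimit.ofπ' g zero fun h w =>
      ⟨(H h w).choose, (H h w).choose_spec⟩⟩

/-- Cokernels become pushouts along a map to zero, so that the results on pushouts in `Z⁰(C)` and
`Z⁰(C^♮)` apply to cokernels without separate proofs. -/
lemma isPushout_zero_iff {O : E} (hO : IsZero O) {a : X ⟶ O} {b : O ⟶ Z} :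
    IsPushout f a g b ↔ f ≫ g = 0 ∧ Epi g ∧
      ∀ {W : E} (h : Y ⟶ W), f ≫ h = 0 → ∃ k : Z ⟶ W, g ≫ k = h := by
  constructor
  · intro H
    refine ⟨by rw [H.w, hO.eq_of_src b 0, comp_zero], ⟨fun k k' e => H.hom_ext e
      (hO.eq_of_src _ _)⟩, fun h w => ?_⟩
    exact ⟨H.desc h 0 (by rw [w, comp_zero]), H.inl_desc _ _ _⟩
  · rintro ⟨zero, _, H⟩
    have (s : PushoutCocone f a) : ∃ k, g ≫ k = s.inl :=
      H s.inl (by rw [s.condition, hO.eq_of_src s.inr 0, comp_zero])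
    refine ⟨⟨by rw [zero, hO.eq_of_src b 0, comp_zero]⟩, ⟨PushoutCocone.IsColimit.mk _
      (fun s => (this s).choose) (fun s => (this s).choose_spec) (fun s => hO.eq_of_src _ _)
      (fun s m e _ => ?_)⟩⟩
    rw [← cancel_epi g, e, (this s).choose_spec]

lemma isPullback_zero_iff {O : E} (hO : IsZero O) {a : X ⟶ O} {b : O ⟶ Z} :
    IsPullback f a g b ↔ f ≫ g = 0 ∧ Mono f ∧
      ∀ {W : E} (h : W ⟶ Y), h ≫ g = 0 → ∃ k : W ⟶ X, k ≫ f = h := by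
  constructor
  · intro H
    refine ⟨by rw [H.w, hO.eq_of_src b 0, comp_zero], ⟨fun k k' e => H.hom_ext e
      (hO.eq_of_tgt _ _)⟩, fun h w => ?_⟩
    exact ⟨H.lift h 0 (by rw [w, zero_comp]), H.lift_fst _ _ _⟩
  · rintro ⟨zero, _, H⟩
    have (s : PullbackCone g b) : ∃ k, k ≫ f = s.fst :=
      H s.fst (s.condition.trans (by simp [hO.eq_of_src b 0]))
    refine ⟨⟨by rw [zero, hO.eq_of_src b 0, comp_zero]⟩, ⟨PullbackCone.IsLimit.mk _
      (fun s => (this s).choose) (fun s => (this s).choose_spec) (fun s => hO.eq_of_tgt _ _)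
      (fun s m e _ => ?_)⟩⟩
    rw [← cancel_mono f, e, (this s).choose_spec]

end KernelCokernel

/-! ### Consequences of Quillen's axioms. -/

namespace ExactStructure

variable {E : Type u} [Category.{v} E] [Preadditive E] (S : ExactStructure E)

variable {S} in
lemma kernel_of_admissible {X Y Z : E} {f : X ⟶ Y} {g : Y ⟶ Z} {zero : f ≫ g = 0}
    (h : S.admissible (ShortComplex.mk f g zero)) :
    Mono f ∧ ∀ {W : E} (h : W ⟶ Y), h ≫ g = 0 → ∃ k : W ⟶ X, k ≫ f = h :=
  nonempty_isLimit_kernelFork_iff.1 (S.isKernel _ h)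

variable {S} in
lemma cokernel_of_admissible {X Y Z : E} {f : X ⟶ Y} {g : Y ⟶ Z} {zero : f ≫ g = 0}
    (h : S.admissible (ShortComplex.mk f g zero)) :
    Epi g ∧ ∀ {W : E} (h : Y ⟶ W), f ≫ h = 0 → ∃ k : Z ⟶ W, g ≫ k = h :=
  nonempty_isColimit_cokernelCofork_iff.1 (S.isCokernel _ h)

variable {S} in
lemma epi_of_admissibleEpi {Y Z : E} {g : Y ⟶ Z} (h : IsAdmissibleEpi S.admissible g) :
    Epi g := by
  obtain ⟨X, f, zero, h⟩ := h
  exact (cokernel_of_admissible h).1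

variable {S} in
/-- An admissible monomorphism together with a cokernel forms an admissible sequence. -/
lemma admissible_of_cokernel {X Y Z : E} {f : X ⟶ Y} {g : Y ⟶ Z} (zero : f ≫ g = 0)
    (hf : IsAdmissibleMono S.admissible f) (hg : Epi g)
    (H : ∀ {W : E} (h : Y ⟶ W), f ≫ h = 0 → ∃ k : Z ⟶ W, g ≫ k = h) :
    S.admissible (ShortComplex.mk f g zero) := by
  obtain ⟨Z', g', zero', h⟩ := hf
  obtain ⟨_, H'⟩ := cokernel_of_admissible h
  obtain ⟨k, hk⟩ := H g' zero'
  obtain ⟨l, hl⟩ := H' g zero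
  refine S.of_iso (S := ShortComplex.mk f g' zero') (ShortComplex.isoMk (Iso.refl _) (Iso.refl _)
    { hom := l, inv := k, hom_inv_id := ?_, inv_hom_id := ?_ } ?_ ?_) h
  · rw [← cancel_epi g', reassoc_of% hl, hk, Category.comp_id]
  · rw [← cancel_epi g, reassoc_of% hk, hl, Category.comp_id]
  · simp
  · simp [hl]

variable {S} in
/-- An admissible epimorphism together with a kernel forms an admissible sequence. -/
lemma admissible_of_kernel {X Y Z : E} {f : X ⟶ Y} {g : Y ⟶ Z} (zero : f ≫ g = 0)
    (hg : IsAdmissibleEpi S.admissible g) (hf : Mono f)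
    (H : ∀ {W : E} (h : W ⟶ Y), h ≫ g = 0 → ∃ k : W ⟶ X, k ≫ f = h) :
    S.admissible (ShortComplex.mk f g zero) := by
  obtain ⟨X', f', zero', h⟩ := hg
  obtain ⟨_, H'⟩ := kernel_of_admissible h
  obtain ⟨k, hk⟩ := H f' zero'
  obtain ⟨l, hl⟩ := H' f zero
  refine S.of_iso (S := ShortComplex.mk f' g zero') (ShortComplex.isoMk
    { hom := k, inv := l, hom_inv_id := ?_, inv_hom_id := ?_ } (Iso.refl _) (Iso.refl _) ?_ ?_) h
  · rw [← cancel_mono f', Category.assoc, hl, hk, Category.id_comp]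
  · rw [← cancel_mono f, Category.assoc, hk, hl, Category.id_comp]
  · simp [hk]
  · simp

variable {S} in
lemma admissibleMono_comp_iso {X Y Z : E} {f : X ⟶ Y} (hf : IsAdmissibleMono S.admissible f)
    (e : Y ≅ Z) : IsAdmissibleMono S.admissible (f ≫ e.hom) := by
  obtain ⟨Z', g, zero, h⟩ := hf
  exact ⟨Z', e.inv ≫ g, by simp [zero],
    S.of_iso (S := ShortComplex.mk f g zero) (ShortComplex.isoMk (Iso.refl _) e
      (Iso.refl _) (by simp) (by simp)) h⟩

variable {S} in
lemma admissibleEpi_iso_comp {X Y Z : E} {g : Y ⟶ Z} (hg : IsAdmissibleEpi S.admissible g)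
    (e : X ≅ Y) : IsAdmissibleEpi S.admissible (e.hom ≫ g) := by
  obtain ⟨X', f, zero, h⟩ := hg
  exact ⟨X', f ≫ e.inv, by simp [zero],
    S.of_iso (S := ShortComplex.mk f g zero) (ShortComplex.isoMk (Iso.refl _) e.symm
      (Iso.refl _) (by simp) (by simp)) h⟩

variable {S} in
lemma admissibleMono_of_isPushout {X Y X' Y' : E} {f : X ⟶ Y} {a : X ⟶ X'} {b : Y ⟶ Y'}
    {f' : X' ⟶ Y'} (sq : IsPushout f a b f') (hf : IsAdmissibleMono S.admissible f) :
    IsAdmissibleMono S.admissible f' := by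
  obtain ⟨Y'', b', f'', sq', h⟩ := S.pushout f a hf
  have := admissibleMono_comp_iso h (sq'.isoIsPushout _ _ sq)
  rwa [sq'.inr_isoIsPushout_hom] at this

variable {S} in
lemma admissibleEpi_of_isPullback {Y Z Y' Z' : E} {g : Y ⟶ Z} {c : Z' ⟶ Z} {b : Y' ⟶ Y}
    {g' : Y' ⟶ Z'} (sq : IsPullback b g' g c) (hg : IsAdmissibleEpi S.admissible g) :
    IsAdmissibleEpi S.admissible g' := by
  obtain ⟨Y'', b', g'', sq', h⟩ := S.pullback g c hg
  have := admissibleEpi_iso_comp h (sq.isoIsPullback _ _ sq')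
  rwa [sq.isoIsPullback_hom_snd] at this

/-- An identity is an admissible monomorphism, and its cokernel is zero. -/
lemma admissibleEpi_to_zero (X : E) {O : E} (hO : IsZero O) (t : X ⟶ O) :
    IsAdmissibleEpi S.admissible t := by
  obtain ⟨Z, g, zero, h⟩ := S.mono_id X
  obtain ⟨_, H⟩ := cokernel_of_admissible h
  refine ⟨X, 𝟙 X, hO.eq_of_tgt _ _, admissible_of_cokernel _ ⟨Z, g, zero, h⟩
    ⟨fun _ _ _ => hO.eq_of_src _ _⟩ fun h w => ⟨0, ?_⟩⟩
  rw [comp_zero, ← Category.id_comp h, w]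

/-- Split short exact sequences are admissible. -/
lemma admissible_of_section {X Y Z : E} {f : X ⟶ Y} {g : Y ⟶ Z} (zero : f ≫ g = 0)
    (hf : Mono f) (H : ∀ {W : E} (h : W ⟶ Y), h ≫ g = 0 → ∃ k : W ⟶ X, k ≫ f = h)
    (s : Z ⟶ Y) (hs : s ≫ g = 𝟙 Z) : S.admissible (ShortComplex.mk f g zero) := by
  have := S.hasFiniteBiproducts
  refine admissible_of_kernel zero ?_ hf H
  obtain ⟨O, hO⟩ := HasZeroObject.zero (C := E)
  -- The idempotent complementary to `g ≫ s` is killed by `g`, so it factors through the kernel; the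
  -- factor `r` is a retraction of `f`.
  obtain ⟨r, hr⟩ := H (𝟙 Y - g ≫ s) (by simp [hs])
  have hfr : f ≫ r = 𝟙 X := by
    rw [← cancel_mono f, Category.assoc, hr]
    simp [reassoc_of% zero]
  have hsr : s ≫ r = 0 := by
    rw [← cancel_mono f, Category.assoc, hr]
    simp [reassoc_of% hs]
  -- The maps `r` and `g` exhibit `Y` as the product of `X` and `Z`, that is, the pullback over
  -- zero; so `g` is a pullback of the admissible epimorphism `X ⟶ O`.
  refine admissibleEpi_of_isPullback (b := r) (c := (0 : Z ⟶ O)) ⟨⟨hO.eq_of_tgt _ _⟩,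
    ⟨PullbackCone.IsLimit.mk _ (fun c => c.fst ≫ f + c.snd ≫ s) (fun c => by simp [hfr, hsr])
      (fun c => by simp [zero, hs]) (fun c m e e' => ?_)⟩⟩ (S.admissibleEpi_to_zero X hO 0)
  rw [← e, ← e', Category.assoc, Category.assoc, ← Preadditive.comp_add, hr]
  simp

variable {S} in
/-- A morphism with a kernel is an admissible epimorphism if its composite with an
admissible epimorphism is. -/
lemma admissible_of_comp_admissibleEpi {P X Y Z : E} {p : P ⟶ Y} {f : X ⟶ Y} {g : Y ⟶ Z}
    (zero : f ≫ g = 0) (hp : IsAdmissibleEpi S.admissible p)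
    (hpg : IsAdmissibleEpi S.admissible (p ≫ g)) (hf : Mono f)
    (H : ∀ {W : E} (h : W ⟶ Y), h ≫ g = 0 → ∃ k : W ⟶ X, k ≫ f = h) :
    S.admissible (ShortComplex.mk f g zero) := by
  obtain ⟨K, k, hk, hkpg⟩ := hpg
  obtain ⟨_, Hk⟩ := kernel_of_admissible hkpg
  obtain ⟨_, Hpg⟩ := cokernel_of_admissible hkpg
  have := epi_of_admissibleEpi hp
  obtain ⟨q, hq⟩ := H (k ≫ p) (by rw [Category.assoc, hk])
  -- The pullback of `p` along `f` is an admissible epimorphism onto `X`. Its source maps to `K`,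
  -- the kernel of `p ≫ g`, so it factors through `q`.
  have hqe : Epi q := by
    obtain ⟨P', b, q', sq, hq'⟩ := S.pullback p f hp
    obtain ⟨t, ht⟩ := Hk b (by rw [reassoc_of% sq.w, zero, comp_zero])
    have e : t ≫ q = q' := by
      rw [← cancel_mono f, Category.assoc, hq, reassoc_of% ht, sq.w]
    have : Epi (t ≫ q) := e ▸ epi_of_admissibleEpi hq'
    exact epi_of_epi t q
  -- This square exhibits `f` as a pushout of the admissible monomorphism `k`. A map out of `P` that
  -- agrees on `K` with a map from `X` vanishes on the kernel of `p`, because that kernel lies in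
  -- `K` and is killed by `q`; hence it factors through `p`.
  have sq : IsPushout k q p f := by
    obtain ⟨L, l, hl, hlp⟩ := hp
    obtain ⟨_, Hp⟩ := cokernel_of_admissible hlp
    obtain ⟨m, hm⟩ := Hk l (by rw [reassoc_of% hl, zero_comp])
    have hmq : m ≫ q = 0 := by
      rw [← cancel_mono f, Category.assoc, hq, reassoc_of% hm, hl, zero_comp]
    have key : ∀ {W : E} (α : P ⟶ W) (β : X ⟶ W), k ≫ α = q ≫ β → ∃ γ : Y ⟶ W, p ≫ γ = α := by
      intro W α β e
      exact Hp α (by rw [← hm, Category.assoc, e, reassoc_of% hmq, zero_comp])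
    refine ⟨⟨hq.symm⟩, ⟨PushoutCocone.IsColimit.mk _ (fun s => (key _ _ s.condition).choose)
      (fun s => (key _ _ s.condition).choose_spec) (fun s => ?_) (fun s m' e _ => ?_)⟩⟩
    · rw [← cancel_epi q, reassoc_of% hq, (key _ _ s.condition).choose_spec, s.condition]
    · rw [← cancel_epi p, e, (key _ _ s.condition).choose_spec]
  refine admissible_of_cokernel zero (admissibleMono_of_isPushout sq ⟨Z, _, hk, hkpg⟩)
    (epi_of_epi p g) fun h w => ?_
  obtain ⟨δ, hδ⟩ := Hpg (p ≫ h) (by rw [← reassoc_of% hq, w, comp_zero])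
  exact ⟨δ, by rw [← cancel_epi p, ← Category.assoc, hδ]⟩

end ExactStructure

/-! ### Morphisms into and out of `Ξ(A)`, and cancellation of shift isomorphisms. -/

namespace XiData

variable {Γ : Type w} [AddCommGroup Γ] [GradingDatum Γ] {C : Type u} [DGCategory.{w, v, u} Γ C]

/-- Since `π = d π'` and `f` is closed, the component of `f` along `π` is the differential of its
component along `π'`. Hence the latter alone determines `f`. -/
lemma comp_π_val {A E : C} (a : XiData (Γ := Γ) A E) {Y : ZZero Γ C} (f : Y ⟶ ⟨E⟩) :
    comp a.π (ZZero.val f) (add_zero _) =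
      d (-one) 0 (neg_add_cancel _) (comp a.π' (ZZero.val f) (add_zero _)) := by
  rw [leibniz a.π' (ZZero.val f) _ (neg_add_cancel _) (zero_add _) _ (by abel) (by abel), a.d_π',
    ZZero.d_val, dcomp_zero, smul_zero, add_zero]

lemma comp_val_ι {A E : C} (a : XiData (Γ := Γ) A E) {Y : ZZero Γ C} (f : (⟨E⟩ : ZZero Γ C) ⟶ Y) :
    comp (ZZero.val f) a.ι (zero_add _) =
      d 0 one (zero_add _) (comp (ZZero.val f) a.ι' (add_zero _)) := by
  rw [leibniz (ZZero.val f) a.ι' _ (zero_add _) (zero_add _) _ (by abel) (by abel), a.d_ι',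
    ZZero.d_val, zero_dcomp, sign_deg_zero, one_smul, zero_add]

lemma eq_add {A E : C} (a : XiData (Γ := Γ) A E) {Y : C} {i : Γ} (f : Hom Y E i) :
    f = comp a.ι (comp a.π' f rfl) (by abel) + comp a.ι' (comp a.π f rfl) (by abel) := by
  have := congrArg (fun t => comp t f (zero_add i)) a.sum
  simp only [DGCategory.add_comp, DGCategory.id_comp] at this
  rw [← DGCategory.assoc a.ι a.π' f (add_neg_cancel _) rfl (zero_add i),
    ← DGCategory.assoc a.ι' a.π f (add_zero _) rfl (zero_add i), this]

lemma eq_add' {A E : C} (a : XiData (Γ := Γ) A E) {Y : C} {i : Γ} (f : Hom E Y i) :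
    f = comp (comp f a.ι rfl) a.π' (by abel) + comp (comp f a.ι' rfl) a.π (by abel) := by
  have := congrArg (fun t => comp f t (add_zero i)) a.sum
  simp only [DGCategory.comp_add, DGCategory.comp_id] at this
  rw [DGCategory.assoc f a.ι a.π' rfl (add_neg_cancel _) _ (add_zero i),
    DGCategory.assoc f a.ι' a.π rfl (add_zero _) _ (add_zero i), this]

/-- Closed morphisms of degree `0` to `Ξ(A)` are arbitrary morphisms of degree `-1` to `A`. -/
lemma existsUnique_to {A E : C} (a : XiData (Γ := Γ) A E) (Y : ZZero Γ C)
    (p : Hom Y.obj A (-one : Γ)) :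
    ∃! f : Y ⟶ ⟨E⟩, comp a.π' (ZZero.val f) (add_zero _) = p := by
  -- The morphism is `ι p + ι' (d p)`. It is closed because `ι` has odd degree, so `d (ι p) = -ι (d
  -- p)`, which cancels `d (ι' (d p)) = ι (d p)`.
  refine ⟨ZZero.homMk (comp a.ι p (add_neg_cancel _) +
    comp a.ι' (d (-one) 0 (neg_add_cancel _) p) (add_zero _)) ?_, ?_, fun f hf => ?_⟩
  · rw [map_add, leibniz a.ι p _ rfl (neg_add_cancel _) rfl (by abel) (by abel), a.d_ι,
      leibniz a.ι' (d (-one) 0 (neg_add_cancel _) p) _ (zero_add _) rfl rfl (by abel) (by abel),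
      a.d_ι', d_d]
    simp [sign_deg_one, Units.smul_def]
  · simp only [ZZero.val_homMk, DGCategory.comp_add]
    rw [← DGCategory.assoc a.π' a.ι p (neg_add_cancel _) _ (zero_add _), a.π'_ι,
      ← DGCategory.assoc a.π' a.ι' _ (add_zero _) _ (add_zero _), a.π'_ι']
    simp [id_comp']
  · ext
    rw [a.eq_add (ZZero.val f)]
    subst hf
    simp only [ZZero.val_homMk, ← comp_π_val]
    simp only [comp_eq, mul_dcast, dcast_dcast]

/-- Closed morphisms of degree `0` from `Ξ(A)` are arbitrary morphisms of degree `0` from `A`. -/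
lemma existsUnique_from {A E : C} (a : XiData (Γ := Γ) A E) (Y : ZZero Γ C)
    (p : Hom A Y.obj (0 : Γ)) :
    ∃! f : (⟨E⟩ : ZZero Γ C) ⟶ Y, comp (ZZero.val f) a.ι' (add_zero _) = p := by
  -- The morphism is `(d p) π' + p π`; the two contributions `∓ (d p) π` to its differential cancel.
  refine ⟨ZZero.homMk (comp (d 0 one (zero_add _) p) a.π' (add_neg_cancel _) +
    comp p a.π (add_zero _)) ?_, ?_, fun f hf => ?_⟩
  · rw [map_add, leibniz (d 0 one (zero_add _) p) a.π' _ rfl (neg_add_cancel _) rfl (by abel)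
      (by abel), a.d_π', leibniz p a.π _ (zero_add _) rfl rfl (by abel) (by abel), a.d_π, d_d]
    simp [sign_deg_one, Units.smul_def]
  · simp only [ZZero.val_homMk, DGCategory.add_comp]
    rw [DGCategory.assoc _ a.π' a.ι' _ (add_zero _) _ (add_neg_cancel _), a.π'_ι',
      DGCategory.assoc p a.π a.ι' _ (add_zero _) _ (add_zero _), a.π_ι']
    simp [comp_id']
  · ext
    rw [a.eq_add' (ZZero.val f)]
    subst hf
    simp only [ZZero.val_homMk, ← comp_val_ι]
    simp only [comp_eq, dcast_mul, dcast_dcast]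

end XiData

namespace ShiftData

variable {Γ : Type w} [AddCommGroup Γ] [GradingDatum Γ] {C : Type u} [DGCategory.{w, v, u} Γ C]

lemma inv_hom_comp {i : Γ} {X Y : C} (s : ShiftData i X Y) {Z : C} {j k : Γ} (f : Hom Z X j)
    (h : -i + j = k) : comp s.inv (comp s.hom f h) (by rw [← h]; abel) = f := by
  rw [← DGCategory.assoc s.inv s.hom f (add_neg_cancel i) h (zero_add _), s.inv_hom,
    DGCategory.id_comp]

lemma hom_inv_comp {i : Γ} {X Y : C} (s : ShiftData i X Y) {Z : C} {j k : Γ} (f : Hom Z Y j)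
    (h : i + j = k) : comp s.hom (comp s.inv f h) (by rw [← h]; abel) = f := by
  rw [← DGCategory.assoc s.hom s.inv f (neg_add_cancel i) h (zero_add _), s.hom_inv,
    DGCategory.id_comp]

lemma comp_inv_hom {i : Γ} {X Y : C} (s : ShiftData i X Y) {Z : C} {j k : Γ} (f : Hom X Z j)
    (h : j + i = k) : comp (comp f s.inv h) s.hom (by rw [← h]; abel) = f := by
  rw [DGCategory.assoc f s.inv s.hom h (add_neg_cancel i) _ (add_zero _), s.inv_hom,
    DGCategory.comp_id]

lemma comp_hom_inv {i : Γ} {X Y : C} (s : ShiftData i X Y) {Z : C} {j k : Γ} (f : Hom Y Z j)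
    (h : j + -i = k) : comp (comp f s.hom h) s.inv (by rw [← h]; abel) = f := by
  rw [DGCategory.assoc f s.hom s.inv h (neg_add_cancel i) _ (add_zero _), s.hom_inv,
    DGCategory.comp_id]

end ShiftData

/-! ### Universal properties in `Z⁰(C)` extend to morphisms of every degree. -/

namespace ZZero

variable {Γ : Type w} [AddCommGroup Γ] [GradingDatum Γ] {C : Type u} [DGCategory.{w, v, u} Γ C]

lemma comp_val_comp {X Y Z : ZZero Γ C} {V : C} {i : Γ} (p : Hom Z.obj V i) (f : X ⟶ Y)
    (g : Y ⟶ Z) : comp p (val (f ≫ g)) (add_zero i) =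
      comp (comp p (val g) (add_zero i)) (val f) (add_zero i) := by
  rw [val_comp, DGCategory.assoc]

lemma val_comp_comp {X Y Z : ZZero Γ C} {V : C} {i : Γ} (p : Hom V X.obj i) (f : X ⟶ Y)
    (g : Y ⟶ Z) : comp (val (f ≫ g)) p (zero_add i) =
      comp (val g) (comp (val f) p (zero_add i)) (zero_add i) := by
  rw [val_comp, DGCategory.assoc]

@[simp] lemma val_zero {X Y : ZZero Γ C} : val (0 : X ⟶ Y) = 0 := rfl

variable [HasShifts Γ C] [HasCones Γ C]

/-- Arbitrary morphisms of degree `i` to a given object are represented in `Z⁰(C)`. -/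
lemma exists_representing_to (V : C) (i : Γ) : ∃ (R : ZZero Γ C) (u : Hom R.obj V i),
    ∀ (Y : ZZero Γ C) (p : Hom Y.obj V i), ∃! f : Y ⟶ R, comp u (val f) (add_zero i) = p := by
  -- Shifting by `i + 1` turns degree `i` morphisms to `V` into degree `-1` morphisms to `W`, the
  -- ones that `Ξ(W)` represents.
  obtain ⟨W, ⟨s⟩⟩ : ∃ W, Nonempty (ShiftData (i + one) V W) := ⟨_, ⟨HasShifts.data (i + one) V⟩⟩
  obtain ⟨E, ⟨a⟩⟩ : ∃ E, Nonempty (XiData (Γ := Γ) W E) := ⟨_, ⟨xiData ⟨W⟩⟩⟩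
  refine ⟨⟨E⟩, comp s.inv a.π' (by abel), fun Y p => ?_⟩
  obtain ⟨f, hf, hf'⟩ := a.existsUnique_to Y (comp s.hom p (by abel))
  refine ⟨f, ?_, fun g hg => hf' g ?_⟩
  · beta_reduce
    rw [DGCategory.assoc s.inv a.π' (val f) _ (add_zero _) _ (by abel), hf, s.inv_hom_comp]
  · subst hg
    rw [DGCategory.assoc s.inv a.π' (val g) _ (add_zero _) _ (by abel), s.hom_inv_comp]

/-- Arbitrary morphisms of degree `i` from a given object are corepresented in `Z⁰(C)`. -/
lemma exists_representing_from (V : C) (i : Γ) : ∃ (R : ZZero Γ C) (u : Hom V R.obj i),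
    ∀ (Y : ZZero Γ C) (p : Hom V Y.obj i), ∃! f : R ⟶ Y, comp (val f) u (zero_add i) = p := by
  -- Here the target degree is `0`, so the shift is by `-i` without correction.
  obtain ⟨W, ⟨s⟩⟩ : ∃ W, Nonempty (ShiftData (-i) V W) := ⟨_, ⟨HasShifts.data (-i) V⟩⟩
  obtain ⟨E, ⟨a⟩⟩ : ∃ E, Nonempty (XiData (Γ := Γ) W E) := ⟨_, ⟨xiData ⟨W⟩⟩⟩
  refine ⟨⟨E⟩, comp a.ι' s.hom (by abel), fun Y p => ?_⟩
  obtain ⟨f, hf, hf'⟩ := a.existsUnique_from Y (comp p s.inv (by abel))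
  refine ⟨f, ?_, fun g hg => hf' g ?_⟩
  · beta_reduce
    rw [← DGCategory.assoc (val f) a.ι' s.hom (add_zero _) _ (by abel), hf, s.comp_inv_hom]
  · subst hg
    rw [← DGCategory.assoc (val g) a.ι' s.hom (add_zero _) _ (by abel), s.comp_hom_inv]

section

variable {X Y X' Y' : ZZero Γ C} {f : X ⟶ Y} {a : X ⟶ X'} {b : Y ⟶ Y'} {f' : X' ⟶ Y'}

/-- A pushout in `Z⁰(C)` has its universal property for morphisms of arbitrary degree. -/
lemma existsUnique_desc (sq : IsPushout f a b f') {V : C} {i : Γ} (p : Hom Y.obj V i)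
    (q : Hom X'.obj V i)
    (h : comp p (val f) (add_zero i) = comp q (val a) (add_zero i)) :
    ∃! r : Hom Y'.obj V i,
      comp r (val b) (add_zero i) = p ∧ comp r (val f') (add_zero i) = q := by
  -- With `Hom^i(-, V)` represented by `R`, the claim is the ordinary universal property of the
  -- pushout tested against `R`.
  obtain ⟨R, u, H⟩ := exists_representing_to V i
  obtain ⟨p₀, rfl, -⟩ := H Y p
  obtain ⟨q₀, rfl, -⟩ := H X' q
  have e : f ≫ p₀ = a ≫ q₀ := (H X _).unique rfl (by rw [comp_val_comp, ← h, comp_val_comp])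
  refine ⟨comp u (val (sq.desc p₀ q₀ e)) (add_zero i), ⟨?_, ?_⟩, ?_⟩
  · rw [← comp_val_comp, sq.inl_desc]
  · rw [← comp_val_comp, sq.inr_desc]
  · rintro r ⟨h₁, h₂⟩
    obtain ⟨r₀, rfl, -⟩ := H Y' r
    rw [← comp_val_comp] at h₁ h₂
    rw [sq.hom_ext ((H _ _).unique h₁ rfl |>.trans (sq.inl_desc _ _ _).symm)
      ((H _ _).unique h₂ rfl |>.trans (sq.inr_desc _ _ _).symm)]

lemma desc_ext (sq : IsPushout f a b f') {V : C} {i : Γ} {r r' : Hom Y'.obj V i}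
    (h₁ : comp r (val b) (add_zero i) = comp r' (val b) (add_zero i))
    (h₂ : comp r (val f') (add_zero i) = comp r' (val f') (add_zero i)) : r = r' :=
  (existsUnique_desc sq (comp r (val b) (add_zero i)) (comp r (val f') (add_zero i)) (by
    rw [← comp_val_comp, ← comp_val_comp, sq.w])).unique ⟨rfl, rfl⟩ ⟨h₁.symm, h₂.symm⟩

end

section

variable {Y Z Y' Z' : ZZero Γ C} {b : Y' ⟶ Y} {g' : Y' ⟶ Z'} {g : Y ⟶ Z} {c : Z' ⟶ Z}

/-- A pullback in `Z⁰(C)` has its universal property for morphisms of arbitrary degree. -/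
lemma existsUnique_lift (sq : IsPullback b g' g c) {V : C} {i : Γ} (p : Hom V Y.obj i)
    (q : Hom V Z'.obj i)
    (h : comp (val g) p (zero_add i) = comp (val c) q (zero_add i)) :
    ∃! r : Hom V Y'.obj i,
      comp (val b) r (zero_add i) = p ∧ comp (val g') r (zero_add i) = q := by
  obtain ⟨R, u, H⟩ := exists_representing_from V i
  obtain ⟨p₀, rfl, -⟩ := H Y p
  obtain ⟨q₀, rfl, -⟩ := H Z' q
  have e : p₀ ≫ g = q₀ ≫ c := (H Z _).unique rfl (by rw [val_comp_comp, ← h, val_comp_comp])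
  refine ⟨comp (val (sq.lift p₀ q₀ e)) u (zero_add i), ⟨?_, ?_⟩, ?_⟩
  · rw [← val_comp_comp, sq.lift_fst]
  · rw [← val_comp_comp, sq.lift_snd]
  · rintro r ⟨h₁, h₂⟩
    obtain ⟨r₀, rfl, -⟩ := H Y' r
    rw [← val_comp_comp] at h₁ h₂
    rw [sq.hom_ext ((H _ _).unique h₁ rfl |>.trans (sq.lift_fst _ _ _).symm)
      ((H _ _).unique h₂ rfl |>.trans (sq.lift_snd _ _ _).symm)]

lemma lift_ext (sq : IsPullback b g' g c) {V : C} {i : Γ} {r r' : Hom V Y'.obj i}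
    (h₁ : comp (val b) r (zero_add i) = comp (val b) r' (zero_add i))
    (h₂ : comp (val g') r (zero_add i) = comp (val g') r' (zero_add i)) : r = r' :=
  (existsUnique_lift sq (comp (val b) r (zero_add i)) (comp (val g') r (zero_add i)) (by
    rw [← val_comp_comp, ← val_comp_comp, sq.w])).unique ⟨rfl, rfl⟩ ⟨h₁.symm, h₂.symm⟩

end

end ZZero

/-! ### The functor `Ψ⁺` is faithful and creates pushouts and pullbacks. -/

namespace ZZero

variable {Γ : Type w} [AddCommGroup Γ] [GradingDatum Γ] {C : Type u} [DGCategory.{w, v, u} Γ C]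

/-- The contracting homotopy of an object of `C^♮`. -/
def homotopy (X : ZZero Γ (Bec Γ C)) :
    Hom ((psiPlus Γ C).obj X).obj ((psiPlus Γ C).obj X).obj (-one : Γ) := X.obj.σ

lemma d_homotopy (X : ZZero Γ (Bec Γ C)) :
    d (-one) 0 (neg_add_cancel _) (homotopy X) = DGCategory.id _ := X.obj.d_σ

lemma homotopy_homotopy (X : ZZero Γ (Bec Γ C)) :
    comp (homotopy X) (homotopy X) rfl = 0 := X.obj.σ_σ

/-- This is closedness for `d^♮` in degree `0`, where the sign is `1`. -/
lemma homotopy_comp_psiPlus_map {X Y : ZZero Γ (Bec Γ C)} (f : X ⟶ Y) :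
    comp (homotopy Y) (val ((psiPlus Γ C).map f)) (add_zero _) =
      comp (val ((psiPlus Γ C).map f)) (homotopy X) (zero_add _) := by
  have h : comp Y.obj.σ (val f).1 (by abel : -one + -0 = -(0 + one : Γ)) -
      sign (0 : Γ) • comp (val f).1 X.obj.σ (by abel) = 0 :=
    congrArg Subtype.val (d_val f rfl)
  rw [sign_deg_zero, one_smul, sub_eq_zero] at h
  have h' := congrArg (dcast (show -(0 + one : Γ) = -one by simp)) h
  rw [dcast_comp, dcast_comp] at h'
  have h₁ := comp_dcast Y.obj.σ (val f).1 neg_zero (add_zero _)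
  have h₂ := dcast_comp_left (val f).1 X.obj.σ neg_zero (zero_add _)
  exact (h₁.trans h').trans h₂.symm

lemma becHom_d {X Y : Bec Γ C} (k : Hom X.obj Y.obj (0 : Γ)) (hk : d 0 (0 + one) rfl k = 0) :
    d (-0) (-0 + one) rfl (dcast neg_zero.symm k) = 0 := by
  rw [d_dcast]
  exact (d_eq_zero_iff _ _ k).1 hk

lemma becHom_commutator {X Y : Bec Γ C} (k : Hom X.obj Y.obj (0 : Γ))
    (h : comp Y.σ k (add_zero _) = comp k X.σ (zero_add _)) :
    Bec.commutator (X := X) (Y := Y) 0 (0 + one) rfl (dcast neg_zero.symm k) = 0 := by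
  suffices key : comp Y.σ (dcast neg_zero.symm k) (by abel : -one + -0 = -(0 + one : Γ)) =
      sign (0 : Γ) • comp (dcast neg_zero.symm k) X.σ (by abel) from sub_eq_zero.2 key
  rw [sign_deg_zero, one_smul, comp_dcast, dcast_comp_left]
  have := congrArg (dcast (show -one = -(0 + one : Γ) by simp)) h
  rwa [dcast_comp, dcast_comp] at this

/-- A closed morphism of degree `0` commuting with the contracting homotopies, as a morphism in
`Z⁰(C^♮)`. -/
def becHomMk {X Y : ZZero Γ (Bec Γ C)} (k : (psiPlus Γ C).obj X ⟶ (psiPlus Γ C).obj Y)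
    (h : comp (homotopy Y) (val k) (add_zero _) = comp (val k) (homotopy X) (zero_add _)) :
    X ⟶ Y :=
  homMk (Γ := Γ) (C := Bec Γ C) ⟨dcast neg_zero.symm (val k), becHom_d (X := X.obj) (Y := Y.obj)
    (val k) (d_val k rfl)⟩ (Subtype.ext (becHom_commutator (X := X.obj) (Y := Y.obj) (val k) h))

@[simp] lemma psiPlus_map_becHomMk {X Y : ZZero Γ (Bec Γ C)}
    (k : (psiPlus Γ C).obj X ⟶ (psiPlus Γ C).obj Y)
    (h : comp (homotopy Y) (val k) (add_zero _) = comp (val k) (homotopy X) (zero_add _)) :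
    (psiPlus Γ C).map (becHomMk k h) = k := hom_ext (dcast_dcast _ _ _)

instance : (psiPlus Γ C).Faithful where
  map_injective {X Y f g} h := by
    have hc (k : X ⟶ Y) : (val k).1 = dcast neg_zero.symm (val ((psiPlus Γ C).map k)) :=
      (dcast_dcast (X := X.obj.obj) (Y := Y.obj.obj) neg_zero neg_zero.symm (val k).1).symm
    exact Subtype.ext (Subtype.ext ((hc f).trans ((congrArg _ (congrArg val h)).trans
      (hc g).symm)))

section

variable [HasShifts Γ C] [HasCones Γ C]

/-- The map `k` induced in `Z⁰(C)` lifts to `Z⁰(C^♮)` once it commutes with the contracting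
homotopies. Both `σ k` and `k σ` have degree `-1` and agree on the two legs, so uniqueness in degree
`-1` makes them equal. -/
lemma isPushout_of_psiPlus {X Y X' Y' : ZZero Γ (Bec Γ C)} {f : X ⟶ Y} {a : X ⟶ X'} {b : Y ⟶ Y'}
    {f' : X' ⟶ Y'} (sq : IsPushout ((psiPlus Γ C).map f) ((psiPlus Γ C).map a)
      ((psiPlus Γ C).map b) ((psiPlus Γ C).map f')) : IsPushout f a b f' := by
  have key (s : PushoutCocone f a) : ∃ k : Y' ⟶ s.pt, b ≫ k = s.inl ∧ f' ≫ k = s.inr := by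
    let k := sq.desc ((psiPlus Γ C).map s.inl) ((psiPlus Γ C).map s.inr) (by
      rw [← Functor.map_comp, ← Functor.map_comp, s.condition])
    have hb : (psiPlus Γ C).map b ≫ k = (psiPlus Γ C).map s.inl := sq.inl_desc _ _ _
    have hf : (psiPlus Γ C).map f' ≫ k = (psiPlus Γ C).map s.inr := sq.inr_desc _ _ _
    have aux {W : ZZero Γ (Bec Γ C)} (t : W ⟶ Y') (r : W ⟶ s.pt)
        (h : (psiPlus Γ C).map t ≫ k = (psiPlus Γ C).map r) :
        comp (comp (homotopy s.pt) (val k) (add_zero _)) (val ((psiPlus Γ C).map t)) (add_zero _) =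
        comp (comp (val k) (homotopy Y') (zero_add _)) (val ((psiPlus Γ C).map t))
          (add_zero _) := by
      rw [DGCategory.assoc _ _ _ _ (add_zero 0) _ (add_zero _), ← val_comp, h,
        homotopy_comp_psiPlus_map,
        DGCategory.assoc _ _ _ _ (add_zero _) _ (zero_add _), homotopy_comp_psiPlus_map,
        ← val_comp_comp,
        h]
    exact ⟨becHomMk k (desc_ext sq (aux b s.inl hb) (aux f' s.inr hf)),
      (psiPlus Γ C).map_injective (by simpa using hb),
      (psiPlus Γ C).map_injective (by simpa using hf)⟩
  refine ⟨⟨(psiPlus Γ C).map_injective (by simpa using sq.w)⟩,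
    ⟨PushoutCocone.IsColimit.mk _ (fun s => (key s).choose) (fun s => (key s).choose_spec.1)
      (fun s => (key s).choose_spec.2) (fun s m e e' => (psiPlus Γ C).map_injective ?_)⟩⟩
  apply sq.hom_ext
  · rw [← Functor.map_comp, ← Functor.map_comp, e, (key s).choose_spec.1]
  · rw [← Functor.map_comp, ← Functor.map_comp, e', (key s).choose_spec.2]

lemma isPullback_of_psiPlus {Y Z Y' Z' : ZZero Γ (Bec Γ C)} {b : Y' ⟶ Y} {g' : Y' ⟶ Z'}
    {g : Y ⟶ Z} {c : Z' ⟶ Z} (sq : IsPullback ((psiPlus Γ C).map b) ((psiPlus Γ C).map g')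
      ((psiPlus Γ C).map g) ((psiPlus Γ C).map c)) : IsPullback b g' g c := by
  have key (s : PullbackCone g c) : ∃ k : s.pt ⟶ Y', k ≫ b = s.fst ∧ k ≫ g' = s.snd := by
    let k := sq.lift ((psiPlus Γ C).map s.fst) ((psiPlus Γ C).map s.snd) (by
      rw [← Functor.map_comp, ← Functor.map_comp, s.condition])
    have hb : k ≫ (psiPlus Γ C).map b = (psiPlus Γ C).map s.fst := sq.lift_fst _ _ _
    have hf : k ≫ (psiPlus Γ C).map g' = (psiPlus Γ C).map s.snd := sq.lift_snd _ _ _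
    have aux {W : ZZero Γ (Bec Γ C)} (t : Y' ⟶ W) (r : s.pt ⟶ W)
        (h : k ≫ (psiPlus Γ C).map t = (psiPlus Γ C).map r) :
        comp (val ((psiPlus Γ C).map t)) (comp (homotopy Y') (val k) (add_zero _)) (zero_add _) =
        comp (val ((psiPlus Γ C).map t)) (comp (val k) (homotopy s.pt) (zero_add _))
          (zero_add _) := by
      rw [← val_comp_comp, h, ← homotopy_comp_psiPlus_map, ← h, comp_val_comp,
        homotopy_comp_psiPlus_map,
        DGCategory.assoc]
    exact ⟨becHomMk k (lift_ext sq (aux b s.fst hb) (aux g' s.snd hf)),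
      (psiPlus Γ C).map_injective (by simpa using hb),
      (psiPlus Γ C).map_injective (by simpa using hf)⟩
  refine ⟨⟨(psiPlus Γ C).map_injective (by simpa using sq.w)⟩,
    ⟨PullbackCone.IsLimit.mk _ (fun s => (key s).choose) (fun s => (key s).choose_spec.1)
      (fun s => (key s).choose_spec.2) (fun s m e e' => (psiPlus Γ C).map_injective ?_)⟩⟩
  apply sq.hom_ext
  · rw [← Functor.map_comp, ← Functor.map_comp, e, (key s).choose_spec.1]
  · rw [← Functor.map_comp, ← Functor.map_comp, e', (key s).choose_spec.2]

/-- The functor `Ψ⁺` creates pushouts. -/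
lemma exists_isPushout_of_psiPlus {X Y X' : ZZero Γ (Bec Γ C)} {f : X ⟶ Y} {a : X ⟶ X'}
    {P : ZZero Γ C} {β : (psiPlus Γ C).obj Y ⟶ P} {φ : (psiPlus Γ C).obj X' ⟶ P}
    (sq : IsPushout ((psiPlus Γ C).map f) ((psiPlus Γ C).map a) β φ) :
    ∃ (Y' : ZZero Γ (Bec Γ C)) (b : Y ⟶ Y') (f' : X' ⟶ Y'),
      IsPushout ((psiPlus Γ C).map f) ((psiPlus Γ C).map a) ((psiPlus Γ C).map b)
        ((psiPlus Γ C).map f') := by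
  -- The homotopies of `Y` and `X'` agree on `X`, so they glue to a degree `-1` endomorphism of the
  -- pushout. The identities `d σ = id` (`hd`) and `σ² = 0` (`hs`) hold after composition with each
  -- leg, hence hold by uniqueness in degrees `0` and `-2`.
  obtain ⟨σ, ⟨hσβ, hσφ⟩, -⟩ := existsUnique_desc sq (comp (val β) (homotopy Y) (zero_add _))
    (comp (val φ) (homotopy X') (zero_add _)) (by
      rw [DGCategory.assoc _ _ _ _ (add_zero _) _ (zero_add _), homotopy_comp_psiPlus_map,
        DGCategory.assoc _ _ _ _ (add_zero _) _ (zero_add _), homotopy_comp_psiPlus_map,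
        ← val_comp_comp,
        sq.w, val_comp_comp])
  have hd {W : ZZero Γ (Bec Γ C)} (t : (psiPlus Γ C).obj W ⟶ P)
      (h : comp σ (val t) (add_zero _) = comp (val t) (homotopy W) (zero_add _)) :
      comp (d (-one) 0 (neg_add_cancel _) σ) (val t) (add_zero 0) =
        comp (DGCategory.id P.obj) (val t) (add_zero 0) := by
    have := congrArg (d (-one) 0 (neg_add_cancel _)) h
    rw [leibniz σ (val t) _ (neg_add_cancel _) (zero_add _) _ (by abel) (by abel), d_val,
      leibniz (val t) (homotopy W) _ (zero_add _) (neg_add_cancel _) _ (by abel) (by abel), d_val,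
      d_homotopy] at this
    simp only [dcomp_zero, smul_zero, add_zero, zero_dcomp, zero_add, sign_deg_zero,
      one_smul] at this
    rw [this, DGCategory.id_comp]
    exact DGCategory.comp_id _
  have hs {W : ZZero Γ (Bec Γ C)} (t : (psiPlus Γ C).obj W ⟶ P)
      (h : comp σ (val t) (add_zero _) = comp (val t) (homotopy W) (zero_add _)) :
      comp (comp σ σ rfl) (val t) (add_zero (-one + -one : Γ)) =
        comp (0 : Hom P.obj P.obj (-one + -one : Γ)) (val t) (add_zero _) := by
    rw [DGCategory.assoc _ _ _ _ (add_zero _) _ rfl, h,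
      ← DGCategory.assoc _ _ _ (add_zero _) _ rfl _, h,
      DGCategory.assoc _ _ _ _ rfl _ (zero_add _), homotopy_homotopy]
    simp
  let Y' : ZZero Γ (Bec Γ C) := ⟨⟨P.obj, σ, desc_ext sq (hd β hσβ) (hd φ hσφ),
    desc_ext sq (hs β hσβ) (hs φ hσφ)⟩⟩
  refine ⟨Y', becHomMk (Y := Y') β hσβ, becHomMk (Y := Y') φ hσφ, ?_⟩
  exact Eq.mp (congrArg₂ (fun b f' => IsPushout _ _ b f')
    (psiPlus_map_becHomMk (Y := Y') β hσβ).symm (psiPlus_map_becHomMk (Y := Y') φ hσφ).symm) sq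

/-- The functor `Ψ⁺` creates pullbacks. -/
lemma exists_isPullback_of_psiPlus {Y Z Z' : ZZero Γ (Bec Γ C)} {g : Y ⟶ Z} {c : Z' ⟶ Z}
    {P : ZZero Γ C} {β : P ⟶ (psiPlus Γ C).obj Y} {φ : P ⟶ (psiPlus Γ C).obj Z'}
    (sq : IsPullback β φ ((psiPlus Γ C).map g) ((psiPlus Γ C).map c)) :
    ∃ (Y' : ZZero Γ (Bec Γ C)) (b : Y' ⟶ Y) (g' : Y' ⟶ Z'),
      IsPullback ((psiPlus Γ C).map b) ((psiPlus Γ C).map g') ((psiPlus Γ C).map g)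
        ((psiPlus Γ C).map c) := by
  -- Dually, the homotopies of `Y` and `Z'`, restricted along the projections, are compatible over
  -- `Z` and define the homotopy of the pullback.
  obtain ⟨σ, ⟨hσβ, hσφ⟩, -⟩ := existsUnique_lift sq (comp (homotopy Y) (val β) (add_zero _))
    (comp (homotopy Z') (val φ) (add_zero _)) (by
      rw [← DGCategory.assoc _ _ _ (zero_add _) _ (add_zero _), ← homotopy_comp_psiPlus_map,
        ← DGCategory.assoc _ _ _ (zero_add _) _ (add_zero _), ← homotopy_comp_psiPlus_map,
        ← comp_val_comp, sq.w, comp_val_comp])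
  have hd {W : ZZero Γ (Bec Γ C)} (t : P ⟶ (psiPlus Γ C).obj W)
      (h : comp (val t) σ (zero_add _) = comp (homotopy W) (val t) (add_zero _)) :
      comp (val t) (d (-one) 0 (neg_add_cancel _) σ) (zero_add 0) =
        comp (val t) (DGCategory.id P.obj) (zero_add 0) := by
    have := congrArg (d (-one) 0 (neg_add_cancel _)) h
    rw [leibniz (val t) σ _ (zero_add _) (neg_add_cancel _) _ (by abel) (by abel), d_val,
      leibniz (homotopy W) (val t) _ (neg_add_cancel _) (zero_add _) _ (by abel) (by abel), d_val,
      d_homotopy] at this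
    simp only [dcomp_zero, smul_zero, add_zero, zero_dcomp, zero_add, sign_deg_zero,
      one_smul] at this
    rw [this, DGCategory.comp_id]
    exact DGCategory.id_comp _
  have hs {W : ZZero Γ (Bec Γ C)} (t : P ⟶ (psiPlus Γ C).obj W)
      (h : comp (val t) σ (zero_add _) = comp (homotopy W) (val t) (add_zero _)) :
      comp (val t) (comp σ σ rfl) (zero_add (-one + -one : Γ)) =
        comp (val t) (0 : Hom P.obj P.obj (-one + -one : Γ)) (zero_add _) := by
    rw [← DGCategory.assoc _ _ _ (zero_add _) _ rfl, h,
      DGCategory.assoc _ _ _ _ (zero_add _) _ rfl, h,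
      ← DGCategory.assoc _ _ _ rfl _ (add_zero _), homotopy_homotopy]
    simp
  let Y' : ZZero Γ (Bec Γ C) := ⟨⟨P.obj, σ, lift_ext sq (hd β hσβ) (hd φ hσφ),
    lift_ext sq (hs β hσβ) (hs φ hσφ)⟩⟩
  refine ⟨Y', becHomMk (X := Y') β hσβ.symm, becHomMk (X := Y') φ hσφ.symm, ?_⟩
  exact Eq.mp (congrArg₂ (fun b g' => IsPullback b g' _ _)
    (psiPlus_map_becHomMk (X := Y') β hσβ.symm).symm
    (psiPlus_map_becHomMk (X := Y') φ hσφ.symm).symm) sq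

end

end ZZero

/-! ### Zero object and biproducts of `Z⁰(C^♮)`. -/

namespace ZZero

variable {Γ : Type w} [AddCommGroup Γ] [GradingDatum Γ] {C : Type u} [DGCategory.{w, v, u} Γ C]

lemma isZero_of_psiPlus {X : ZZero Γ (Bec Γ C)} (h : IsZero ((psiPlus Γ C).obj X)) : IsZero X := by
  rw [IsZero.iff_id_eq_zero]
  exact (psiPlus Γ C).map_injective (h.eq_of_src _ _)

lemma exists_isZero_bec [HasFiniteBiproducts (ZZero Γ C)] :
    ∃ O : ZZero Γ (Bec Γ C), IsZero ((psiPlus Γ C).obj O) := by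
  obtain ⟨O, hO⟩ := HasZeroObject.zero (C := ZZero Γ C)
  have h : (0 : Hom O.obj O.obj (0 : Γ)) = DGCategory.id O.obj :=
    congrArg val (hO.eq_of_src 0 (𝟙 O))
  -- On a zero object the identity is `0`, so `0` is a contracting homotopy.
  exact ⟨⟨⟨O.obj, 0, by rw [map_zero, h], by simp⟩⟩, hO⟩

variable [HasShifts Γ C] [HasCones Γ C]

instance hasFiniteBiproducts_bec [HasFiniteBiproducts (ZZero Γ C)] :
    HasFiniteBiproducts (ZZero Γ (Bec Γ C)) := by
  obtain ⟨O, hO⟩ := exists_isZero_bec (Γ := Γ) (C := C)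
  have hO' := isZero_of_psiPlus hO
  have hc (X Y : ZZero Γ (Bec Γ C)) : HasColimit (pair X Y) := by
    -- A binary coproduct is a pushout over the zero object, and `Ψ⁺` creates pushouts.
    have sq : IsPushout ((psiPlus Γ C).map (0 : O ⟶ X)) ((psiPlus Γ C).map (0 : O ⟶ Y))
        coprod.inl coprod.inr := by
      rw [hO.eq_of_src ((psiPlus Γ C).map (0 : O ⟶ X)) (hO.isInitial.to _),
        hO.eq_of_src ((psiPlus Γ C).map (0 : O ⟶ Y)) (hO.isInitial.to _)]
      exact IsPushout.of_is_coproduct (coprodIsCoprod _ _) hO.isInitial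
    obtain ⟨P, b, c, sq'⟩ := exists_isPushout_of_psiPlus sq
    have sq'' := isPushout_of_psiPlus sq'
    exact ⟨_, isCoproductOfIsInitialIsPushout _ _ _ _ hO'.isInitial sq''.isColimit⟩
  have : HasBinaryCoproducts (ZZero Γ (Bec Γ C)) := hasBinaryCoproducts_of_hasColimit_pair _
  have : HasInitial (ZZero Γ (Bec Γ C)) := hO'.isInitial.hasInitial
  have := hasFiniteCoproducts_of_has_binary_and_initial (C := ZZero Γ (Bec Γ C))
  exact HasFiniteBiproducts.of_hasFiniteCoproducts

end ZZero

/-! ### The exact structure induced on `Z⁰(C^♮)`. -/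

namespace ExactStructure

variable {Γ : Type w} [AddCommGroup Γ] [GradingDatum Γ] {C : Type u} [DGCategory.{w, v, u} Γ C]
  [HasShifts Γ C] [HasCones Γ C] (S : ExactStructure (ZZero Γ C))

open ZZero

-- Reduces the axioms on admissible monomorphisms of `Z⁰(C^♮)` to those of `S`: a cokernel of the
-- image is a pushout along a map to zero, which `Ψ⁺` creates, so it comes with a contracting
-- homotopy.
variable {S} in
lemma isAdmissibleMono_bec_iff {X Y : ZZero Γ (Bec Γ C)} (f : X ⟶ Y) :
    IsAdmissibleMono (fun A => S.admissible (A.map (psiPlus Γ C))) f ↔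
      IsAdmissibleMono S.admissible ((psiPlus Γ C).map f) := by
  refine ⟨fun ⟨Z, g, zero, h⟩ => ⟨_, _, _, h⟩, fun hf => ?_⟩
  have := S.hasFiniteBiproducts
  obtain ⟨O, hO⟩ := exists_isZero_bec (Γ := Γ) (C := C)
  obtain ⟨Z, g, zero, h⟩ := id hf
  have sq := (isPushout_zero_iff hO (a := (psiPlus Γ C).map 0) (b := 0)).2
    ⟨zero, cokernel_of_admissible h⟩
  obtain ⟨P, b, c, sq'⟩ := exists_isPushout_of_psiPlus sq
  obtain ⟨hz, he, H⟩ := (isPushout_zero_iff hO).1 sq'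
  exact ⟨P, b, (psiPlus Γ C).map_injective (by simpa using hz), admissible_of_cokernel _ hf he H⟩

variable {S} in
lemma isAdmissibleEpi_bec_iff {Y Z : ZZero Γ (Bec Γ C)} (g : Y ⟶ Z) :
    IsAdmissibleEpi (fun A => S.admissible (A.map (psiPlus Γ C))) g ↔
      IsAdmissibleEpi S.admissible ((psiPlus Γ C).map g) := by
  refine ⟨fun ⟨Z, g, zero, h⟩ => ⟨_, _, _, h⟩, fun hg => ?_⟩
  have := S.hasFiniteBiproducts
  obtain ⟨O, hO⟩ := exists_isZero_bec (Γ := Γ) (C := C)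
  obtain ⟨X, f, zero, h⟩ := id hg
  have sq := (isPullback_zero_iff hO (a := 0) (b := (psiPlus Γ C).map 0)).2
    ⟨zero, kernel_of_admissible h⟩
  obtain ⟨P, b, c, sq'⟩ := exists_isPullback_of_psiPlus sq
  obtain ⟨hz, he, H⟩ := (isPullback_zero_iff hO).1 sq'
  exact ⟨P, b, (psiPlus Γ C).map_injective (by simpa using hz), admissible_of_kernel _ hg he H⟩

/-- The exact structure on `Z⁰(C^♮)` whose admissible sequences are those taken to admissible
sequences by `Ψ⁺`. -/
def bec : ExactStructure (ZZero Γ (Bec Γ C)) where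
  hasFiniteBiproducts := have := S.hasFiniteBiproducts; inferInstance
  admissible A := S.admissible (A.map (psiPlus Γ C))
  isKernel A h := by
    have := S.hasFiniteBiproducts
    obtain ⟨O, hO⟩ := exists_isZero_bec (Γ := Γ) (C := C)
    obtain ⟨_, H⟩ := (isPullback_zero_iff (isZero_of_psiPlus hO)).1 (isPullback_of_psiPlus
      ((isPullback_zero_iff hO (f := (psiPlus Γ C).map A.f) (g := (psiPlus Γ C).map A.g)
        (a := (psiPlus Γ C).map 0) (b := (psiPlus Γ C).map 0)).2
        ⟨(A.map (psiPlus Γ C)).zero, kernel_of_admissible h⟩))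
    exact nonempty_isLimit_kernelFork_iff.2 H
  isCokernel A h := by
    have := S.hasFiniteBiproducts
    obtain ⟨O, hO⟩ := exists_isZero_bec (Γ := Γ) (C := C)
    obtain ⟨_, H⟩ := (isPushout_zero_iff (isZero_of_psiPlus hO)).1 (isPushout_of_psiPlus
      ((isPushout_zero_iff hO (f := (psiPlus Γ C).map A.f) (g := (psiPlus Γ C).map A.g)
        (a := (psiPlus Γ C).map 0) (b := (psiPlus Γ C).map 0)).2
        ⟨(A.map (psiPlus Γ C)).zero, cokernel_of_admissible h⟩))
    exact nonempty_isColimit_cokernelCofork_iff.2 H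
  of_iso e h := S.of_iso ((psiPlus Γ C).mapShortComplex.mapIso e) h
  mono_id X := by
    rw [isAdmissibleMono_bec_iff, CategoryTheory.Functor.map_id]
    exact S.mono_id _
  epi_id X := by
    rw [isAdmissibleEpi_bec_iff, CategoryTheory.Functor.map_id]
    exact S.epi_id _
  mono_comp f g hf hg := by
    rw [isAdmissibleMono_bec_iff] at hf hg ⊢
    rw [Functor.map_comp]
    exact S.mono_comp _ _ hf hg
  epi_comp f g hf hg := by
    rw [isAdmissibleEpi_bec_iff] at hf hg ⊢
    rw [Functor.map_comp]
    exact S.epi_comp _ _ hf hg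
  pushout f a hf := by
    rw [isAdmissibleMono_bec_iff] at hf
    obtain ⟨P, b, f', sq, -⟩ := S.pushout _ ((psiPlus Γ C).map a) hf
    obtain ⟨Y', b, f', sq'⟩ := exists_isPushout_of_psiPlus sq
    exact ⟨Y', b, f', isPushout_of_psiPlus sq',
      (isAdmissibleMono_bec_iff _).2 (admissibleMono_of_isPushout sq' hf)⟩
  pullback g c hg := by
    rw [isAdmissibleEpi_bec_iff] at hg
    obtain ⟨P, b, g', sq, -⟩ := S.pullback _ ((psiPlus Γ C).map c) hg
    obtain ⟨Y', b, g', sq'⟩ := exists_isPullback_of_psiPlus sq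
    exact ⟨Y', b, g', isPullback_of_psiPlus sq',
      (isAdmissibleEpi_bec_iff _).2 (admissibleEpi_of_isPullback sq' hg)⟩

end ExactStructure

/-! ### The functor `Ξ`: kernels, cokernels, and the comparison with the cone of `f[-1]`. -/

namespace XiData

variable {Γ : Type w} [AddCommGroup Γ] [GradingDatum Γ] {C : Type u} [DGCategory.{w, v, u} Γ C]
  {A B EA EB : C} (a : XiData (Γ := Γ) A EA) (b : XiData (Γ := Γ) B EB) (f : Hom A B (0 : Γ))

lemma π'_mapHom : comp b.π' (mapHom a b f) (add_zero _) = comp f a.π' (zero_add _) := by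
  simp only [mapHom, comp_eq, mul_dcast, dcast_mul, mul_mul, dcast_dcast, mul_dadd,
    mul_mul_of_comp b.π'_ι', mul_mul_of_comp b.π'_ι, id_mul, dzero_mul, map_zero, add_zero]

lemma π_mapHom : comp b.π (mapHom a b f) (add_zero _) = comp f a.π (zero_add _) := by
  simp only [mapHom, comp_eq, mul_dcast, dcast_mul, mul_mul, dcast_dcast, mul_dadd,
    mul_mul_of_comp b.π_ι', mul_mul_of_comp b.π_ι, id_mul, dzero_mul, map_zero, zero_add]

lemma mapHom_ι' : comp (mapHom a b f) a.ι' (add_zero _) = comp b.ι' f (add_zero _) := by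
  simp only [mapHom, comp_eq, mul_dcast, dcast_mul, mul_mul, dcast_dcast, dadd_mul,
    mul_eq_of_comp a.π_ι', mul_eq_of_comp a.π'_ι', mul_id, mul_dzero, map_zero, zero_add]

lemma mapHom_ι : comp (mapHom a b f) a.ι (zero_add _) = comp b.ι f (add_zero _) := by
  simp only [mapHom, comp_eq, mul_dcast, dcast_mul, mul_mul, dcast_dcast, dadd_mul,
    mul_eq_of_comp a.π_ι, mul_eq_of_comp a.π'_ι, mul_id, mul_dzero, map_zero, add_zero]

end XiData

namespace ZZero

variable {Γ : Type w} [AddCommGroup Γ] [GradingDatum Γ] {C : Type u} [DGCategory.{w, v, u} Γ C]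

section

variable {X Y Z EX EY EZ : ZZero Γ C} (a : XiData (Γ := Γ) X.obj EX.obj)
  (b : XiData (Γ := Γ) Y.obj EY.obj) (c : XiData (Γ := Γ) Z.obj EZ.obj)

lemma hom_ext_to {W : ZZero Γ C} {h h' : W ⟶ EX}
    (e : comp a.π' (val h) (add_zero _) = comp a.π' (val h') (add_zero _)) : h = h' :=
  (a.existsUnique_to W _).unique e rfl

lemma hom_ext_from {W : ZZero Γ C} {h h' : EX ⟶ W}
    (e : comp (val h) a.ι' (add_zero _) = comp (val h') a.ι' (add_zero _)) : h = h' :=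
  (a.existsUnique_from W _).unique e rfl

variable {f : X ⟶ Y} {g : Y ⟶ Z} {F : EX ⟶ EY} {G : EY ⟶ EZ}

-- Maps `W ⟶ Ξ(X)` are degree `-1` maps from `W` to `X`, and composition with `Ξ(f)` corresponds to
-- composition with `f`. This is why the kernel property of `f` is required in every degree.
include a b in
lemma mapHom_kernel (hF : val F = XiData.mapHom a b (val f))
    (hG : val G = XiData.mapHom b c (val g))
    (hinj : ∀ {W : C} {i : Γ} (p q : Hom W X.obj i),
      comp (val f) p (zero_add i) = comp (val f) q (zero_add i) → p = q)
    (hlift : ∀ {W : C} {i : Γ} (p : Hom W Y.obj i), comp (val g) p (zero_add i) = 0 →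
      ∃ q, comp (val f) q (zero_add i) = p) :
    Mono F ∧ ∀ {W : ZZero Γ C} (h : W ⟶ EY), h ≫ G = 0 → ∃ k, k ≫ F = h := by
  have key {W : ZZero Γ C} (h : W ⟶ EX) : comp b.π' (val (h ≫ F)) (add_zero _) =
      comp (val f) (comp a.π' (val h) (add_zero _)) (zero_add _) := by
    rw [comp_val_comp, hF, XiData.π'_mapHom, DGCategory.assoc]
  refine ⟨⟨fun h h' e => hom_ext_to a (hinj _ _ ?_)⟩, fun {W} h e => ?_⟩
  · rw [← key, ← key, e]
  · obtain ⟨q, hq⟩ := hlift (comp b.π' (val h) (add_zero _)) (by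
      have := congrArg (fun t => comp c.π' (val t) (add_zero _)) e
      simp only [comp_val_comp, hG, XiData.π'_mapHom, val_zero, dcomp_zero] at this
      rwa [DGCategory.assoc] at this)
    obtain ⟨k, hk, -⟩ := a.existsUnique_to W q
    exact ⟨k, hom_ext_to b (by rw [key, hk, hq])⟩

-- Dual argument: maps out of `Ξ(Z)` are degree-`0` maps out of `Z`, not necessarily closed, read
-- off by composing with `ι'`.
include b c in
lemma mapHom_cokernel (hF : val F = XiData.mapHom a b (val f))
    (hG : val G = XiData.mapHom b c (val g))
    (hinj : ∀ {W : C} {i : Γ} (p q : Hom Z.obj W i),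
      comp p (val g) (add_zero i) = comp q (val g) (add_zero i) → p = q)
    (hdesc : ∀ {W : C} {i : Γ} (p : Hom Y.obj W i), comp p (val f) (add_zero i) = 0 →
      ∃ q, comp q (val g) (add_zero i) = p) :
    Epi G ∧ ∀ {W : ZZero Γ C} (h : EY ⟶ W), F ≫ h = 0 → ∃ k, G ≫ k = h := by
  have key {W : ZZero Γ C} (h : EZ ⟶ W) : comp (val (G ≫ h)) b.ι' (add_zero _) =
      comp (comp (val h) c.ι' (add_zero _)) (val g) (add_zero _) := by
    rw [val_comp, DGCategory.assoc _ _ _ _ (add_zero _) _ (add_zero _), hG, XiData.mapHom_ι',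
      DGCategory.assoc]
  refine ⟨⟨fun h h' e => hom_ext_from c (hinj _ _ ?_)⟩, fun {W} h e => ?_⟩
  · rw [← key, ← key, e]
  · obtain ⟨q, hq⟩ := hdesc (comp (val h) b.ι' (add_zero _)) (by
      have := congrArg (fun t => comp (val t) a.ι' (add_zero _)) e
      simp only [val_comp, val_zero, zero_dcomp] at this
      rw [DGCategory.assoc _ _ _ _ (add_zero _) _ (add_zero _), hF, XiData.mapHom_ι'] at this
      rwa [DGCategory.assoc _ _ _ _ (add_zero _) _ (add_zero _)])
    obtain ⟨k, hk, -⟩ := c.existsUnique_from W q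
    exact ⟨k, hom_ext_from b (by rw [key, hk, hq])⟩

end

section

variable {X Y K X' Y' EX EY : ZZero Γ C}

/-- The comparison of the cones of the identities of `X[-1]` and `Y[-1]` with the cone of
`f[-1]`. -/
lemma isPushout_of_isPullback [HasShifts Γ C] [HasCones Γ C]
    (a : XiData (Γ := Γ) X.obj EX.obj) (b : XiData (Γ := Γ) Y.obj EY.obj)
    (sX : ShiftData (-one : Γ) X.obj X'.obj) (sY : ShiftData (-one : Γ) Y.obj Y'.obj)
    {f : X ⟶ Y} {f' : X' ⟶ Y'} {iX : X' ⟶ EX} {iY : Y' ⟶ EY} {pX : EX ⟶ X} {pY : EY ⟶ Y}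
    {F : EX ⟶ EY} {k : K ⟶ EY} {q : K ⟶ X} {j : Y' ⟶ K} {t : EX ⟶ K}
    (hf' : comp (val f') sX.hom (zero_add _) = comp sY.hom (val f) (add_zero _))
    (hiX : comp (val iX) sX.hom (by simp) = a.ι) (hiY : comp (val iY) sY.hom (by simp) = b.ι)
    (hpX : val pX = a.π) (hpY : val pY = b.π) (hF : val F = XiData.mapHom a b (val f))
    (sq : IsPullback k q pY f) (hjk : j ≫ k = iY) (hjq : j ≫ q = 0) (htk : t ≫ k = F)
    (htq : t ≫ q = pX) : IsPushout f' iX j t := by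
  have hcan {W : C} {i : Γ} (u v : Hom X'.obj W i)
      (e : comp u sX.hom rfl = comp v sX.hom rfl) : u = v := by
    rw [← sX.comp_hom_inv u rfl, e, sX.comp_hom_inv]
  have hcanY {W : C} {i : Γ} (u v : Hom Y'.obj W i)
      (e : comp u sY.hom rfl = comp v sY.hom rfl) : u = v := by
    rw [← sY.comp_hom_inv u rfl, e, sY.comp_hom_inv]
  have hw : f' ≫ iY = iX ≫ F := by
    ext
    apply hcan
    have e₁ := mul_eq_of_comp hf'
    have e₂ := mul_eq_of_comp hiX
    have e₃ := mul_mul_of_comp hiY (val f)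
    have e₄ := mul_eq_of_comp (XiData.mapHom_ι a b (val f))
    simp only [val_comp, comp_eq, dcast_mul, mul_mul, dcast_dcast, e₁, e₂, mul_dcast, e₃, hF, e₄]
  have hXw : iX ≫ pX = 0 := by
    ext
    apply hcan
    simp only [val_comp, comp_eq, dcast_mul, mul_mul, dcast_dcast, mul_eq_of_comp hiX, hpX,
      mul_dcast, mul_eq_of_comp a.π_ι]
    simp
  have hkt : comp (val k) (val t) (add_zero _) = XiData.mapHom a b (val f) := by
    rw [← val_comp, htk, hF]
  have hqt : comp (val q) (val t) (add_zero _) = a.π := by rw [← val_comp, htq, hpX]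
  have hpk : comp b.π (val k) (add_zero _) = comp (val f) (val q) (add_zero _) := by
    rw [← hpY, ← val_comp, ← val_comp, sq.w]
  have hkj : comp (val k) (val j) (add_zero _) = val iY := by rw [← val_comp, hjk]
  have hqj : comp (val q) (val j) (add_zero _) = 0 := by rw [← val_comp, hjq, val_zero]
  -- As a graded object `K` is `Y[-1] ⊕ X`: the inclusions are `j` and `t ι'`, the projections are
  -- `π' k` (up to the shift isomorphism) and `q`. The decomposition of the identity is checked on
  -- the two projections of the pullback.
  have hid : comp (comp (comp (val j) sY.hom (by simp : 0 + -(-one) = (one : Γ))) b.π'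
      (add_neg_cancel _)) (val k) (add_zero _) +
      comp (comp (val t) a.ι' (add_zero _)) (val q) (add_zero _) = DGCategory.id K.obj := by
    apply lift_ext sq
    · rw [DGCategory.comp_id]
      conv_rhs => rw [b.eq_add (val k)]
      simp only [comp_eq, dcast_mul, mul_mul, dcast_dcast, mul_dcast, mul_dadd, map_add,
        mul_mul_of_comp hkj, mul_mul_of_comp hiY, mul_eq_of_comp hpk, mul_mul_of_comp hkt,
        mul_mul_of_comp (XiData.mapHom_ι' a b (val f))]
    · simp only [comp_eq, dcast_mul, mul_mul, dcast_dcast, mul_dcast, mul_dadd,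
        mul_mul_of_comp hqj, mul_mul_of_comp hqt, mul_mul_of_comp a.π_ι', id_mul, mul_id,
        dzero_mul, map_zero, zero_add]
  have hπ'iY : comp b.π' (val iY) (add_zero _) = sY.inv := by
    apply hcanY
    simp only [comp_eq, dcast_mul, mul_mul, dcast_dcast, mul_dcast, mul_eq_of_comp hiY,
      mul_eq_of_comp b.π'_ι, mul_eq_of_comp sY.inv_hom]
  have hdesc {W : ZZero Γ C} (β : Y' ⟶ W) (α : EX ⟶ W) (e : f' ≫ β = iX ≫ α) :
      ∃ γ : K ⟶ W, j ≫ γ = β ∧ t ≫ γ = α := by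
    have hB := d_comp_of_closed (val β) sY.hom (by simp : 0 + -(-one) = (one : Γ)) rfl rfl rfl
      (d_val β rfl) sY.d_hom
    have hBf : comp (comp (val β) sY.hom (by simp : 0 + -(-one) = (one : Γ))) (val f)
        (add_zero _) = comp (val α) a.ι (zero_add _) := by
      have := congrArg (fun z => comp (val z) sX.hom (by simp : 0 + -(-one) = (one : Γ))) e
      simp only [val_comp, comp_eq, dcast_mul, mul_mul, dcast_dcast, mul_dcast,
        mul_eq_of_comp hf', mul_eq_of_comp hiX] at this
      simpa only [comp_eq, dcast_mul, mul_mul, dcast_dcast] using this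
    -- The identity `hBf` in a form that rewrites inside longer composites, for an arbitrary final
    -- degree.
    have hBf' {V : C} {l n : Γ} (z : Hom V X.obj l) (h : 0 + (-(-one) + (0 + l)) = n) :
        dcast h (mul (val β) (mul sY.hom (mul (val f) z))) =
          dcast (by rw [← h]; simp) (mul (val α) (mul a.ι z)) := by
      subst h
      have := congrArg (fun x => comp x z (by simp : one + l = 0 + (-(-one) + (0 + l)))) hBf
      simpa only [comp_eq, dcast_mul, mul_dcast, mul_mul, dcast_dcast, dcast_rfl] using this
    -- The formula is `β` and `α` applied to the two summands in `hid`. Its differential is `-B f q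
    -- + α ι q`, with `B = β ∘ sY.hom`, and vanishes by `hBf`, which encodes the compatibility of
    -- `β` and `α` on `X'`.
    refine ⟨homMk (comp (comp (comp (val β) sY.hom (by simp : 0 + -(-one) = (one : Γ))) b.π'
      (add_neg_cancel _)) (val k) (add_zero _) +
      comp (comp (val α) a.ι' (add_zero _)) (val q) (add_zero _)) ?_, ?_, ?_⟩
    · rw [map_add, leibniz _ (val k) _ (zero_add _) (zero_add _) _ (by abel) (by abel), d_val,
        leibniz _ b.π' _ rfl (neg_add_cancel _) _ (by abel) (by abel), hB, b.d_π',
        leibniz _ (val q) _ (zero_add _) (zero_add _) _ (by abel) (by abel), d_val,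
        leibniz _ a.ι' _ (zero_add _) (zero_add _) _ (by abel) (by abel), d_val, a.d_ι']
      simp only [dcomp_zero, zero_dcomp, smul_zero, add_zero, zero_add, sign_deg_zero, one_smul,
        sign_deg_one, smul_comp]
      simp only [comp_eq, dcast_mul, mul_mul, dcast_dcast, mul_dcast, mul_eq_of_comp hpk]
      rw [hBf']
      simp [Units.smul_def]
    · ext
      simp only [val_comp, val_homMk, comp_eq, dcast_mul, mul_mul, dcast_dcast, mul_dcast,
        dadd_mul, mul_eq_of_comp hkj, mul_eq_of_comp hqj, mul_eq_of_comp hπ'iY,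
        mul_eq_of_comp sY.hom_inv, mul_id, mul_dzero, map_zero, add_zero, dcast_rfl]
    · ext
      conv_rhs => rw [a.eq_add' (val α)]
      simp only [val_comp, val_homMk, comp_eq, dcast_mul, mul_mul, dcast_dcast, mul_dcast,
        dadd_mul, map_add, mul_eq_of_comp hkt, mul_eq_of_comp hqt,
        mul_eq_of_comp (XiData.π'_mapHom a b (val f))]
      rw [hBf']
  -- Composing `m` with `hid` expresses it through `j ≫ m` and `t ≫ m`.
  have hext {W : ZZero Γ C} {m m' : K ⟶ W} (e : j ≫ m = j ≫ m') (e' : t ≫ m = t ≫ m') :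
      m = m' := by
    have aux (m : K ⟶ W) : val m = comp (comp (comp (val (j ≫ m)) sY.hom
        (by simp : 0 + -(-one) = (one : Γ))) b.π' (add_neg_cancel _)) (val k) (add_zero _) +
        comp (comp (val (t ≫ m)) a.ι' (zero_add _)) (val q) (add_zero _) := by
      have := congrArg (fun z => comp (val m) z (add_zero _)) hid
      simp only [DGCategory.comp_id] at this
      rw [← this]
      simp only [val_comp, comp_eq, dcast_mul, mul_mul, dcast_dcast, mul_dcast, mul_dadd, map_add]
    ext
    rw [aux m, aux m', e, e']
  refine ⟨⟨?_⟩, ⟨PushoutCocone.IsColimit.mk _ (fun s => (hdesc _ _ s.condition).choose)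
    (fun s => (hdesc _ _ s.condition).choose_spec.1)
    (fun s => (hdesc _ _ s.condition).choose_spec.2) (fun s m e e' => ?_)⟩⟩
  · apply sq.hom_ext
    · rw [Category.assoc, Category.assoc, hjk, htk, hw]
    · rw [Category.assoc, Category.assoc, hjq, htq, hXw, comp_zero]
  · exact hext (e.trans (hdesc _ _ s.condition).choose_spec.1.symm)
      (e'.trans (hdesc _ _ s.condition).choose_spec.2.symm)

end

end ZZero

/-! ### Composites of `Ψ⁺` with shifts and with `Φ`; exactness properties of `Ξ`. -/

namespace ZZero

variable (Γ : Type w) [AddCommGroup Γ] [GradingDatum Γ] (C : Type u) [DGCategory.{w, v, u} Γ C]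
  [HasShifts Γ C]

/-- The functor `Ψ⁺` takes the shift by `[i]` to the shift by `[-i]`. -/
def shiftFunctorCompPsiPlus (i : Γ) :
    shiftFunctor (Bec Γ C) i ⋙ psiPlus Γ C ≅ psiPlus Γ C ⋙ shiftFunctor C (-i) :=
  NatIso.ofComponents (fun X => Iso.refl ((shiftFunctor C (-i)).obj ((psiPlus Γ C).obj X)))
    fun {X Y} f => by
      refine (Category.comp_id _).trans (Eq.trans ?_ (Category.id_comp _).symm)
      apply hom_ext
      have e (p : Hom X.obj.obj Y.obj.obj (-0 : Γ)) (s : ShiftData (-i) X.obj.obj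
          (HasShifts.shift (-i) X.obj.obj)) (t : ShiftData (-i) Y.obj.obj
          (HasShifts.shift (-i) Y.obj.obj)) : dcast neg_zero (comp (comp t.hom p (by abel :
            -(-i) + -0 = -(-i))) s.inv (by abel)) =
          comp (comp t.hom (dcast neg_zero p) (add_zero _)) s.inv (neg_add_cancel _) := by
        rw [dcast_comp, comp_dcast]
      exact e (val f).1 _ _

variable [HasCones Γ C]

/-- The composite of `Φ` and `Ψ⁺` is `Ξ`. -/
def phiCompPsiPlus : phi Γ C ⋙ psiPlus Γ C ≅ xi Γ C :=
  NatIso.ofComponents (fun X => Iso.refl ((xi Γ C).obj X)) fun {X Y} f => by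
    refine (Category.comp_id _).trans (Eq.trans ?_ (Category.id_comp _).symm)
    apply hom_ext
    exact dcast_dcast (X := xiObj X) (Y := xiObj Y) neg_zero.symm neg_zero _

variable {Γ C}

/-- The structure morphisms of `cone(id_A[-1])`, on the object `Ξ(A)`. -/
def xiData' (A : ZZero Γ C) : XiData (Γ := Γ) A.obj ((xi Γ C).obj A).obj := xiData A

/-- The shift isomorphism between `A` and `A[-1]`. -/
def shiftData (A : ZZero Γ C) :
    ShiftData (-one : Γ) A.obj ((shiftFunctor C (-one)).obj A).obj := HasShifts.data (-one) A.obj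

lemma val_xi_map {A B : ZZero Γ C} (f : A ⟶ B) :
    val ((xi Γ C).map f) = XiData.mapHom (xiData' A) (xiData' B) (val f) := rfl

lemma val_fromXi (A : ZZero Γ C) : val (fromXi Γ C A) = (xiData' A).π := rfl

lemma val_toXi_comp_hom (A : ZZero Γ C) :
    comp (val (toXi Γ C A)) (shiftData A).hom (by simp : 0 + -(-one) = (one : Γ)) =
      (xiData' A).ι := rfl

omit [HasCones Γ C] in
lemma val_shift_map_comp_hom {A B : ZZero Γ C} (f : A ⟶ B) :
    comp (val ((shiftFunctor C (-one)).map f)) (shiftData A).hom (zero_add _) =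
      comp (shiftData B).hom (val f) (add_zero _) :=
  (HasShifts.data (-one) A.obj).comp_inv_hom _ _

lemma xi_map_fromXi {A B : ZZero Γ C} (f : A ⟶ B) :
    (xi Γ C).map f ≫ fromXi Γ C B = fromXi Γ C A ≫ f := by
  ext
  rw [val_comp, val_comp, val_xi_map, val_fromXi, val_fromXi, XiData.π_mapHom]

lemma toXi_fromXi (A : ZZero Γ C) : toXi Γ C A ≫ fromXi Γ C A = 0 := (xiSequence Γ C A).zero

instance : (xi Γ C).Faithful where
  map_injective {X Y f g} h := by
    -- The morphism is recovered as `π Ξ(k) ι'`.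
    have key (k : X ⟶ Y) : val k = comp (xiData' Y).π (comp (val ((xi Γ C).map k)) (xiData' X).ι'
        (add_zero _)) (add_zero _) := by
      rw [val_xi_map, XiData.mapHom_ι', ← DGCategory.assoc (xiData' Y).π (xiData' Y).ι' (val k)
        (add_zero _) (add_zero _) (zero_add _), (xiData' Y).π_ι', DGCategory.id_comp]
    ext
    rw [key f, key g, h]

instance : (phi Γ C).Faithful := Functor.Faithful.of_comp_iso (phiCompPsiPlus Γ C)

section

variable [HasFiniteBiproducts (ZZero Γ C)] {X Y Z : ZZero Γ C} {f : X ⟶ Y} {g : Y ⟶ Z}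

/-- A kernel is a pullback over zero, hence has its universal property in all degrees, as
`mapHom_kernel` requires. -/
lemma xi_kernel (zero : f ≫ g = 0) (hf : Mono f ∧ ∀ {W : ZZero Γ C} (h : W ⟶ Y), h ≫ g = 0 →
      ∃ k : W ⟶ X, k ≫ f = h) : Mono ((xi Γ C).map f) ∧
    ∀ {W : ZZero Γ C} (h : W ⟶ (xi Γ C).obj Y), h ≫ (xi Γ C).map g = 0 →
      ∃ k, k ≫ (xi Γ C).map f = h := by
  obtain ⟨O, hO⟩ := HasZeroObject.zero (C := ZZero Γ C)
  have sq := (isPullback_zero_iff hO (a := 0) (b := 0)).2 ⟨zero, hf⟩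
  refine mapHom_kernel (xiData' X) (xiData' Y) (xiData' Z) (val_xi_map f) (val_xi_map g)
    (fun p q e => lift_ext sq e (by simp)) (fun {W i} p hp => ?_)
  obtain ⟨q, hq, -⟩ := existsUnique_lift sq p (0 : Hom W O.obj i) (by simpa using hp)
  exact ⟨q, hq.1⟩

lemma xi_cokernel (zero : f ≫ g = 0) (hg : Epi g ∧ ∀ {W : ZZero Γ C} (h : Y ⟶ W), f ≫ h = 0 →
      ∃ k : Z ⟶ W, g ≫ k = h) : Epi ((xi Γ C).map g) ∧
    ∀ {W : ZZero Γ C} (h : (xi Γ C).obj Y ⟶ W), (xi Γ C).map f ≫ h = 0 →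
      ∃ k, (xi Γ C).map g ≫ k = h := by
  obtain ⟨O, hO⟩ := HasZeroObject.zero (C := ZZero Γ C)
  have sq := (isPushout_zero_iff hO (a := 0) (b := 0)).2 ⟨zero, hg⟩
  refine mapHom_cokernel (xiData' X) (xiData' Y) (xiData' Z) (val_xi_map f) (val_xi_map g)
    (fun p q e => desc_ext sq e (by simp)) (fun {W i} p hp => ?_)
  obtain ⟨q, hq, -⟩ := existsUnique_desc sq p (0 : Hom O.obj W i) (by simpa using hp)
  exact ⟨q, hq.1⟩

end

/-- If a closed `h` satisfies `π h = 0`, then `π' h` is closed because `d (π' h) = π h`; being of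
degree `-1`, it amounts to a closed degree-`0` map to `A[-1]`. -/
lemma toXi_kernel (A : ZZero Γ C) : Mono (toXi Γ C A) ∧
    ∀ {W : ZZero Γ C} (h : W ⟶ (xi Γ C).obj A), h ≫ fromXi Γ C A = 0 →
      ∃ k, k ≫ toXi Γ C A = h := by
  have hπ' : comp (xiData' A).π' (val (toXi Γ C A)) (add_zero _) = (shiftData A).inv := by
    rw [← (shiftData A).comp_hom_inv (comp (xiData' A).π' (val (toXi Γ C A)) (add_zero _))
      (add_neg_cancel _),
      DGCategory.assoc _ _ _ _ (by simp : 0 + - -one = (one : Γ)) _ (neg_add_cancel _),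
      val_toXi_comp_hom, (xiData' A).π'_ι, DGCategory.id_comp]
  refine ⟨⟨fun {W} h h' e => ?_⟩, fun {W} h e => ?_⟩
  · have := congrArg (fun z => comp (xiData' A).π' (val z) (add_zero _)) e
    simp only [comp_val_comp, hπ'] at this
    ext
    rw [← (shiftData A).hom_inv_comp (val h) (add_zero _), this, (shiftData A).hom_inv_comp]
  · have hπ : comp (xiData' A).π (val h) (add_zero _) = 0 := congrArg val e
    refine ⟨homMk (comp (shiftData A).hom (comp (xiData' A).π' (val h) (add_zero _))
      (neg_add_cancel _)) (d_comp_of_closed _ _ _ rfl (neg_add_cancel _) rfl (shiftData A).d_hom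
        (by rw [← XiData.comp_π_val, hπ])), hom_ext_to (xiData' A) ?_⟩
    rw [comp_val_comp, hπ', val_homMk, (shiftData A).inv_hom_comp]

lemma exists_section_xi_map_fromXi (A : ZZero Γ C) :
    ∃ s : (xi Γ C).obj A ⟶ (xi Γ C).obj ((xi Γ C).obj A),
      s ≫ (xi Γ C).map (fromXi Γ C A) = 𝟙 _ := by
  -- The section corresponds to the contracting homotopy `ι' π'` of `Ξ(A)`; it works because `π (ι'
  -- π') = π'`.
  obtain ⟨s, hs, -⟩ := (xiData' ((xi Γ C).obj A)).existsUnique_to ((xi Γ C).obj A)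
    (comp (xiData' A).ι' (xiData' A).π' (zero_add _))
  refine ⟨s, hom_ext_to (xiData' A) ?_⟩
  rw [comp_val_comp, val_xi_map, XiData.π'_mapHom,
    DGCategory.assoc _ _ _ _ (add_zero _) _ (zero_add _), hs, val_fromXi,
    ← DGCategory.assoc _ _ _ (add_zero _) _ (zero_add _), (xiData' A).π_ι',
    DGCategory.id_comp, val_id, DGCategory.comp_id]

end ZZero

/-! ### DG-compatibility against `♮`-compatibility. -/

namespace ExactStructure

variable {Γ : Type w} [AddCommGroup Γ] [GradingDatum Γ] {C : Type u} [DGCategory.{w, v, u} Γ C]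
  [HasShifts Γ C] [HasCones Γ C] {S : ExactStructure (ZZero Γ C)}

open ZZero

/-- No compatibility of `S` is needed, since the image under `Ξ` is split. -/
lemma admissible_xi_map_xiSequence (A : ZZero Γ C) :
    S.admissible ((xiSequence Γ C A).map (xi Γ C)) := by
  have := S.hasFiniteBiproducts
  obtain ⟨s, hs⟩ := exists_section_xi_map_fromXi A
  obtain ⟨h₁, h₂⟩ := xi_kernel (toXi_fromXi A) (toXi_kernel A)
  exact S.admissible_of_section _ h₁ h₂ s hs

lemma IsDGCompatible.xi_preserves (hS : S.IsDGCompatible) : S.Preserves S (xi Γ C) := by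
  rintro ⟨f, g, zero⟩ h
  rename_i X Y Z
  have := S.hasFiniteBiproducts
  have hπ : IsAdmissibleEpi S.admissible (fromXi Γ C Y) :=
    ⟨_, _, _, hS.admissible_xiSequence Y⟩
  obtain ⟨_, H⟩ := kernel_of_admissible h
  obtain ⟨K, k, q, sq, -⟩ := S.pullback (fromXi Γ C Y) f hπ
  -- As `f` is a kernel of `g`, its pullback `k` is a kernel of `Ξ(Y) → Y → Z`, a composite of
  -- admissible epimorphisms.
  have hk : IsAdmissibleMono S.admissible k := by
    refine ⟨Z, fromXi Γ C Y ≫ g, by rw [reassoc_of% sq.w, zero, comp_zero],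
      admissible_of_kernel _ (S.epi_comp _ _ hπ ⟨X, f, zero, h⟩) ⟨fun u v e => ?_⟩ fun u e => ?_⟩
    · refine sq.hom_ext e ?_
      rw [← cancel_mono f, Category.assoc, Category.assoc, ← sq.w, reassoc_of% e]
    · obtain ⟨l, hl⟩ := H (u ≫ fromXi Γ C Y) (by rwa [Category.assoc])
      exact ⟨sq.lift u l hl.symm, sq.lift_fst _ _ _⟩
  let j := sq.lift (toXi Γ C Y) 0 (by rw [toXi_fromXi, zero_comp])
  let t := sq.lift ((xi Γ C).map f) (fromXi Γ C X) (xi_map_fromXi f)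
  have htk : t ≫ k = (xi Γ C).map f := sq.lift_fst _ _ _
  have po : IsPushout ((shiftFunctor C (-one : Γ)).map f) (toXi Γ C X) j t :=
    isPushout_of_isPullback (xiData' X) (xiData' Y) (shiftData X) (shiftData Y)
      (val_shift_map_comp_hom f) (val_toXi_comp_hom X) (val_toXi_comp_hom Y) (val_fromXi X)
      (val_fromXi Y) (val_xi_map f) sq (sq.lift_fst _ _ _) (sq.lift_snd _ _ _) htk
      (sq.lift_snd _ _ _)
  have hf : IsAdmissibleMono S.admissible ((shiftFunctor C (-one : Γ)).map f) :=
    ⟨_, _, _, hS.isShiftStable.2 _ h⟩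
  -- `t` is a pushout of `f[-1]`, admissible by shift stability, so `Ξ(f) = t ≫ k` is an admissible
  -- monomorphism; only its cokernel remains to be identified.
  have ht := S.mono_comp _ _ (admissibleMono_of_isPushout po hf) hk
  rw [htk] at ht
  obtain ⟨h₁, h₂⟩ := xi_cokernel zero (cokernel_of_admissible h)
  exact admissible_of_cokernel _ ht h₁ h₂

lemma IsDGCompatible.xi_reflects (hS : S.IsDGCompatible) : S.Reflects S (xi Γ C) := by
  intro X Y Z f g zero' h
  have zero : f ≫ g = 0 := (xi Γ C).map_injective (by simpa using zero')
  have hπ (A : ZZero Γ C) : IsAdmissibleEpi S.admissible (fromXi Γ C A) :=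
    ⟨_, _, _, hS.admissible_xiSequence A⟩
  have hπe (A : ZZero Γ C) : Epi (fromXi Γ C A) := epi_of_admissibleEpi (hπ A)
  obtain ⟨_, H⟩ := kernel_of_admissible h
  have hf : Mono f := (xi Γ C).mono_of_mono_map inferInstance
  -- The obscure axiom is applied to the admissible epimorphism `Ξ(Y) → Y`; by naturality its
  -- composite with `g` is `Ξ(g)` followed by `Ξ(Z) → Z`.
  refine ⟨zero, admissible_of_comp_admissibleEpi zero (hπ Y) ?_ hf fun {W} x hx => ?_⟩
  · rw [← xi_map_fromXi]
    exact S.epi_comp _ _ ⟨_, _, _, h⟩ (hπ Z)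
  · obtain ⟨k, hk⟩ := H ((xi Γ C).map x) (by rw [← Functor.map_comp, hx, Functor.map_zero])
    -- To show that `f` is a kernel, `Ξ(x)` is lifted to `k : Ξ(W) ⟶ Ξ(X)`. Its projection to `X`
    -- kills `W[-1]`, as can be tested after the monomorphism `f`, so it descends to `y : W ⟶ X`.
    obtain ⟨y, hy⟩ := (cokernel_of_admissible (hS.admissible_xiSequence W)).2
      (k ≫ fromXi Γ C X) (by
      rw [← cancel_mono f, Category.assoc, Category.assoc, ← xi_map_fromXi, reassoc_of% hk,
        xi_map_fromXi, reassoc_of% toXi_fromXi W, zero_comp, zero_comp])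
    refine ⟨y, ?_⟩
    rw [← cancel_epi (fromXi Γ C W), reassoc_of% hy, ← xi_map_fromXi, reassoc_of% hk, xi_map_fromXi]

/-- `Ψ⁺` exchanges the shifts `[1]` and `[-1]`, so each half of the stability of `S` gives the
opposite half for `S.bec`. -/
lemma bec_isShiftStable (hS : S.IsShiftStable) : S.bec.IsShiftStable := by
  have key (i j : Γ) (hij : -i = j) (h : S.Preserves S (shiftFunctor C j)) :
      S.bec.Preserves S.bec (shiftFunctor (Bec Γ C) i) := by
    subst hij
    intro A hA
    exact S.of_iso (ShortComplex.mapNatIso A (shiftFunctorCompPsiPlus Γ C i)).symm (h _ hA)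
  exact ⟨key one (-one) rfl hS.2, key (-one) one (neg_neg _) hS.1⟩

lemma bec_admissible_map_phi_iff (A : ShortComplex (ZZero Γ C)) :
    S.bec.admissible (A.map (phi Γ C)) ↔ S.admissible (A.map (xi Γ C)) :=
  ⟨S.of_iso (ShortComplex.mapNatIso A (phiCompPsiPlus Γ C)),
    S.of_iso (ShortComplex.mapNatIso A (phiCompPsiPlus Γ C)).symm⟩

lemma bec_psiPlus_reflects : S.bec.Reflects S (psiPlus Γ C) := fun _ _ zero' h =>
  ⟨(psiPlus Γ C).map_injective (by simpa using zero'), h⟩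

lemma eq_bec_of_psiPlus {T : ExactStructure (ZZero Γ (Bec Γ C))}
    (h₁ : T.Preserves S (psiPlus Γ C)) (h₂ : T.Reflects S (psiPlus Γ C)) : T = S.bec := by
  ext A
  exact ⟨h₁ A, fun h => (h₂ _ _ _ h).2⟩

lemma IsDGCompatible.isBecCompatible_bec (hS : S.IsDGCompatible) : S.IsBecCompatible S.bec where
  isShiftStable := hS.isShiftStable
  isShiftStable_bec := bec_isShiftStable hS.isShiftStable
  phi_preserves A hA := (bec_admissible_map_phi_iff A).2 (hS.xi_preserves A hA)
  phi_reflects {X Y Z} f g zero' h := by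
    have zero : f ≫ g = 0 := (phi Γ C).map_injective (by simpa using zero')
    exact hS.xi_reflects f g _ ((bec_admissible_map_phi_iff (ShortComplex.mk f g zero)).1 h)
  psiPlus_preserves _ h := h
  psiPlus_reflects := bec_psiPlus_reflects

lemma IsBecCompatible.eq_bec {T : ExactStructure (ZZero Γ (Bec Γ C))} (h : S.IsBecCompatible T) :
    T = S.bec := eq_bec_of_psiPlus h.psiPlus_preserves h.psiPlus_reflects

/-- The image of `A[-1] → Ξ(A) → A` under `Φ` is admissible because its image under `Ξ ≅ Ψ⁺ ∘ Φ` is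
split; then `Φ` reflects. -/
lemma IsBecCompatible.isDGCompatible {T : ExactStructure (ZZero Γ (Bec Γ C))}
    (h : S.IsBecCompatible T) : S.IsDGCompatible where
  isShiftStable := h.isShiftStable
  admissible_xiSequence A := by
    obtain rfl := h.eq_bec
    exact (h.phi_reflects _ _ _
      ((bec_admissible_map_phi_iff _).2 (admissible_xi_map_xiSequence A))).2

end ExactStructure

theorem mainTheorem2 {Γ : Type w} [AddCommGroup Γ] [GradingDatum Γ] (C : Type u)
    [DGCategory.{w, v, u} Γ C] [HasFiniteBiproducts (ZZero Γ C)] [HasShifts Γ C] [HasCones Γ C] :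
    (∀ S : ExactStructure (ZZero Γ C), S.IsDGCompatible →
      ∃! T : ExactStructure (ZZero Γ (Bec Γ C)), S.IsBecCompatible T) ∧
    Set.BijOn (ExactDGStructure.base (Γ := Γ) (C := C)) Set.univ {S | S.IsDGCompatible} := by
  refine ⟨fun S hS => ⟨S.bec, hS.isBecCompatible_bec, fun T hT => hT.eq_bec⟩,
    fun E _ => E.compatible.isDGCompatible, ?_,
    fun S hS => ⟨⟨S, S.bec, ExactStructure.IsDGCompatible.isBecCompatible_bec hS⟩, trivial, rfl⟩⟩
  -- Injectivity: the second member of a compatible pair is forced to be `S.bec`.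
  rintro ⟨S, T, h⟩ - ⟨S', T', h'⟩ - (rfl : S = S')
  obtain rfl := h.eq_bec
  obtain rfl := h'.eq_bec
  rfl
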